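/- **Bracket principle.** For $n\ge 1$ let $\Sigma=\{\text{red},\text{blue}\}\times\{\text{opening},\text{closing},\text{trivial}\}\times[n]$; for $\sigma\in\Sigma$ let $b(\sigma)$ denote its coloured bracket and $p(\sigma)\in[n]$ its pointer (a trivial bracket is an opening and a closing bracket compressed into one symbol). For $s\in\Sigma^n$ write $s_i\sim s_j$ if $p(s_i)=j$ and $p(s_j)=i$. The axioms on $s$ are: - (A1) $b(s_1)$ is a red trivial or red opening bracket, and $b(s_n)$ is a blue trivial or blue closing bracket. - (A2) If $p(s_i)=j$ then $p(s_j)=i$; if $s_i\sim s_i$ then $b(s_i)$ is trivial; if $s_i\sim s_j$ with $i<j$ then $b(s_i)$ is opening, $b(s_j)$ is closing, and their colours agree. - (A3) There are no $i<i'<j<j'$ with $s_i\sim s_j$ and $s_{i'}\sim s_{j'}$. - (A4) There is no $i\in[n-1]$ such that $b(s_i)$ is red closing or red trivial and $b(s_{i+1})$ is blue opening or blue trivial. **Wide formula.** Let $m=\lceil\log_2|\Sigma|\rceil$ and let $\pi:\Sigma\to\{0,1\}^m$ be injective. The CNF $\mathrm{Bracket}_{n,\pi}$ has $m$ variables for each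 index $i\in[n]$, which are meant to hold $\pi(s_i)$. Every instance of an axiom, on the set $S\subseteq[n]$ of at most four indices that it mentions, is translated separately: for each assignment to the $m|S|$ variables of $S$ that is not the code of symbols satisfying the instance, there is the clause, containing all $m|S|$ variables of $S$, that is falsified by exactly this assignment. **Narrow formula.** The index-width of a clause is the number of indices whose variables it mentions. Let $k$ be the maximum index-width of a clause of $\mathrm{Bracket}_{n,\pi}$. The 3-CNF $\mathrm{ExBracket}_{n,\pi}$ has one variable $y_D$ for each clause $D$ (a set of literals over the variables of $\mathrm{Bracket}_{n,\pi}$) of index-width at most $k$. Its clauses are $y_D$ for each clause $D$ of $\mathrm{Bracket}_{n,\pi}$; $y_x\lor y_{\neg x}$ and $\neg y_x\lor\neg y_{\neg x}$ for each variable $x$ of $\mathrm{Bracket}_{n,\pi}$; and $\neg y_D\lor y_A\lor y_B$, $\neg y_A\lor y_D$, $\neg y_B\lor y_D$ for all clauses $A,B,D$ of index-width at most $k$ with $D=A\lor B$. **Theorem.** Every width-$w$ resolution refutation of $\mathrm{ExBracket}_{n,\pi}$ has depth $n^{\Omega(\log n/\log w)}$. That is, there are absolute constants $c>0$ and $N$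 such that for all $n\ge N$, all encodings $\pi$ and all $w\ge 2$, every resolution refutation (with weakening allowed) of $\mathrm{ExBracket}_{n,\pi}$ in which every clause has at most $w$ literals has depth at least $n^{c\log n/\log w}$. Here the depth is the number of inference steps on a longest path from a clause of the formula to the empty clause in the directed acyclic graph of the refutation. -/

import Mathlib

namespace BracketFormula

/-! ### Clauses and resolution -/

/-- A literal is a variable with a sign: `(x, true)` is `x` and `(x, false)` is `¬x`. -/
abbrev Literal (V : Type) := V × Bool

/-- A clause is a finite set of literals, read as their disjunction. -/
abbrev Clause (V : Type) := Finset (Literal V)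

/-- A CNF formula is a set of clauses, read as their conjunction. -/
abbrev CNF (V : Type) := Set (Clause V)

/-- The ways in which the `i`-th line of the sequence of clauses `L` may be justified in a
resolution proof from `F`: it is a clause of `F`, it is the resolvent `A ∨ B` of two earlier lines
`A ∨ x` and `B ∨ ¬x`, or it is a weakening of an earlier line. -/
inductive Step {V : Type} [DecidableEq V] (F : CNF V) {s : ℕ} (L : Fin s → Clause V)
    (i : Fin s) : Type
  | hypothesis (h : L i ∈ F) : Step F L i
  | resolve (j k : Fin s) (hj : j < i) (hk : k < i) (x : V) (A B : Clause V)
      (hA : L j = insert (x, true) A) (hB : L k = insert (x, false) B) (h : L i = A ∪ B) :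
      Step F L i
  | weaken (j : Fin s) (hj : j < i) (h : L j ⊆ L i) : Step F L i

/-- A (dag-like) resolution refutation of `F`: a sequence of justified clauses, one of which is
the empty clause. -/
structure Refutation {V : Type} [DecidableEq V] (F : CNF V) where
  size : ℕ
  line : Fin size → Clause V
  step : ∀ i, Step F line i
  final : Fin size
  line_final : line final = ∅

namespace Refutation

variable {V : Type} [DecidableEq V] {F : CNF V}

/-- The width of a refutation: the maximum number of literals in a clause appearing in it. -/
def width (R : Refutation F) : ℕ :=
  Finset.univ.sup fun i => (R.line i).card

/-- The number of inference steps on a longest path of the proof dag that ends in line `i`. -/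
def lineDepth (R : Refutation F) (i : Fin R.size) : ℕ :=
  match R.step i with
  | .hypothesis _ => 0
  | .resolve j k _ _ _ _ _ _ _ _ => max (R.lineDepth j) (R.lineDepth k) + 1
  | .weaken j _ _ => R.lineDepth j + 1
termination_by i

/-- The depth of a refutation: the length of a longest path from a clause of `F` to the
empty clause. -/
def depth (R : Refutation F) : ℕ :=
  R.lineDepth R.final

end Refutation

/-! ### The bracket principle over a large alphabet -/

inductive Colour : Type
  | red
  | blue

/-- An opening bracket, a closing bracket, or a trivial bracket (an opening and a closing bracket
compressed into one symbol). -/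
inductive Shape : Type
  | opening
  | closing
  | trivial

/-- The alphabet `Σ`: one of six coloured brackets together with a pointer to an index. -/
abbrev Symbol (n : ℕ) := (Colour × Shape) × Fin n

namespace Symbol

variable {n : ℕ}

def colour (a : Symbol n) : Colour := a.1.1

def shape (a : Symbol n) : Shape := a.1.2

def pointer (a : Symbol n) : Fin n := a.2

end Symbol

/-- `s_i ∼ s_j`. -/
def Paired {n : ℕ} (s : Fin n → Symbol n) (i j : Fin n) : Prop :=
  (s i).pointer = j ∧ (s j).pointer = i

/-- A constraint on strings in `Σ ^ n`, together with the set of indices it mentions. -/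
structure Constraint (n : ℕ) where
  indices : Finset (Fin n)
  holds : (Fin n → Symbol n) → Prop

/-- The axioms of the bracket principle. The indices `1, …, n` of the string are here
`0, …, n - 1`. -/
inductive IsAxiom {n : ℕ} : Constraint n → Prop
  /-- The first symbol is `[` or `[]` in red. -/
  | start (i : Fin n) (hi : i.val = 0) :
      IsAxiom ⟨{i}, fun s => (s i).colour = .red ∧
        ((s i).shape = .trivial ∨ (s i).shape = .opening)⟩
  /-- The last symbol is `]` or `[]` in blue. -/
  | finish (i : Fin n) (hi : i.val + 1 = n) :
      IsAxiom ⟨{i}, fun s => (s i).colour = .blue ∧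
        ((s i).shape = .trivial ∨ (s i).shape = .closing)⟩
  /-- Pointers are symmetric. -/
  | pointers (i j : Fin n) :
      IsAxiom ⟨{i, j}, fun s => (s i).pointer = j → (s j).pointer = i⟩
  /-- A symbol paired with itself is a trivial bracket. -/
  | selfPaired (i : Fin n) :
      IsAxiom ⟨{i}, fun s => Paired s i i → (s i).shape = .trivial⟩
  /-- Two distinct paired symbols are an opening and a closing bracket of the same colour. -/
  | paired (i j : Fin n) (hij : i < j) :
      IsAxiom ⟨{i, j}, fun s => Paired s i j →
        (s i).shape = .opening ∧ (s j).shape = .closing ∧ (s i).colour = (s j).colour⟩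
  /-- Bracket pairs do not cross. -/
  | nesting (i i' j j' : Fin n) (h₁ : i < i') (h₂ : i' < j) (h₃ : j < j') :
      IsAxiom ⟨{i, i', j, j'}, fun s => ¬ (Paired s i j ∧ Paired s i' j')⟩
  /-- No red bracket pair ends immediately before the start of a blue bracket pair. -/
  | noTransition (i j : Fin n) (hij : j.val = i.val + 1) :
      IsAxiom ⟨{i, j}, fun s =>
        ¬ (((s i).colour = .red ∧ ((s i).shape = .closing ∨ (s i).shape = .trivial)) ∧
          ((s j).colour = .blue ∧ ((s j).shape = .opening ∨ (s j).shape = .trivial)))⟩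

/-! ### The wide CNF encoding -/

/-- The number of bits that encode one symbol, `⌈log₂ |Σ|⌉`. -/
noncomputable def codeLength (n : ℕ) : ℕ := Nat.clog 2 (Nat.card (Symbol n))

/-- An encoding of the symbols by bit strings, different symbols having different codes. -/
abbrev Encoding (n : ℕ) := Symbol n ↪ (Fin (codeLength n) → Bool)

/-- Variable `(i, b)` is the `b`-th bit of the code of the `i`-th symbol. -/
abbrev BitVar (n : ℕ) := Fin n × Fin (codeLength n)

/-- The clause over the bits of the blocks in `S` which is falsified exactly by the assignments
that agree with `β` on these blocks. -/
noncomputable def excludingClause {n : ℕ} (S : Finset (Fin n)) (β : Fin n → Fin (codeLength n) → Bool) :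
    Clause (BitVar n) :=
  (S ×ˢ Finset.univ).image fun v => (v, !(β v.1 v.2))

/-- The CNF `Bracket`: every axiom is translated separately into the clauses that exclude the
assignments to the blocks it mentions which do not encode symbols satisfying the axiom. -/
def bracket {n : ℕ} (π : Encoding n) : CNF (BitVar n) :=
  {D | ∃ C : Constraint n, IsAxiom C ∧ ∃ β : Fin n → Fin (codeLength n) → Bool,
    (¬ ∃ s : Fin n → Symbol n, (∀ i ∈ C.indices, π (s i) = β i) ∧ C.holds s) ∧
    D = excludingClause C.indices β}

/-! ### The narrow CNF encoding -/

/-- The number of indices mentioned by a clause. -/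
def indexWidth {n : ℕ} (D : Clause (BitVar n)) : ℕ := (D.image fun l => l.1.1).card

/-- The maximum index-width of a clause of `F`. The set is bounded, as index-widths are at
most `n`. -/
noncomputable def formulaIndexWidth {n : ℕ} (F : CNF (BitVar n)) : ℕ := sSup (indexWidth '' F)

/-- The extension variables `y_D`, one for each clause `D` of index-width at most `k`. -/
abbrev ExtVar (n k : ℕ) := {D : Clause (BitVar n) // indexWidth D ≤ k}

/-- The clauses of the 3-CNF `F'` over the extension variables, `k` being the index-width
of `F`. -/
inductive IsExtensionClause {n : ℕ} (F : CNF (BitVar n)) :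
    Clause (ExtVar n (formulaIndexWidth F)) → Prop
  /-- `y_D` for each clause `D` of `F` -/
  | unit (D : ExtVar n (formulaIndexWidth F)) (h : D.1 ∈ F) :
      IsExtensionClause F {(D, true)}
  /-- `y_x ∨ y_{¬x}` -/
  | negation_pos (x : BitVar n) (P N : ExtVar n (formulaIndexWidth F))
      (hP : P.1 = {(x, true)}) (hN : N.1 = {(x, false)}) :
      IsExtensionClause F {(P, true), (N, true)}
  /-- `¬y_x ∨ ¬y_{¬x}` -/
  | negation_neg (x : BitVar n) (P N : ExtVar n (formulaIndexWidth F))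
      (hP : P.1 = {(x, true)}) (hN : N.1 = {(x, false)}) :
      IsExtensionClause F {(P, false), (N, false)}
  /-- `y_D → y_A ∨ y_B` -/
  | disjunction (A B D : ExtVar n (formulaIndexWidth F)) (h : D.1 = A.1 ∪ B.1) :
      IsExtensionClause F {(D, false), (A, true), (B, true)}
  /-- `y_A → y_D` -/
  | disjunction_left (A B D : ExtVar n (formulaIndexWidth F)) (h : D.1 = A.1 ∪ B.1) :
      IsExtensionClause F {(A, false), (D, true)}
  /-- `y_B → y_D` -/
  | disjunction_right (A B D : ExtVar n (formulaIndexWidth F)) (h : D.1 = A.1 ∪ B.1) :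
      IsExtensionClause F {(B, false), (D, true)}

/-- The 3-CNF `ExBracket`. -/
def exBracket {n : ℕ} (π : Encoding n) : CNF (ExtVar n (formulaIndexWidth (bracket π))) :=
  {C | IsExtensionClause (bracket π) C}

end BracketFormula

namespace BracketFormula

/-! ### Layouts: bracket strings with at most one bad transition -/

/-! Read from the empty clause towards its premises, a refutation is a strategy for a prover who
remembers the symbols on a few cells, queries the at most four cells of the resolved variable, and
forgets. An adversary maintains a string that falsifies the current line when each `y_D` gets the
truth value of `D`. No string satisfies all axioms, but a `Layout` violates only axioms that mention
its anchor (`Layout.Confined.holds`). While the anchor is not mentioned, no clause of the formula is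
falsified (`not_falsified`), so surviving `t` rounds forces depth at least `t` (`le_lineDepth`).

The adversary survives by moving the anchor. It passes a run of covered cells by enclosing the run
in a new pair, which covers only cells next to covered ones (`Layout.exists_move`). Runs without a
remembered cell can be erased, so at most `w` runs in the window matter. Place `w + 1` blocks of
length `m` far apart in a window. As long as few cells between the blocks are covered, no run
reaches two blocks, so some block is free and the anchor can be moved there, at the cost of `3 * w`
newly covered cells (`Layout.exists_relocate`). This can be repeated `m` times, with a recursive
game inside the chosen block each time (`survives_window`).

Each level thus multiplies the window length by `10 * w ^ 2` and the number of rounds by the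
previous window length. About `log n / log w` levels fit into `n` cells, and the exponent of the
number of rounds is quadratic in the number of levels. If `w` is large compared with `n`, a
polynomial bound suffices: within depth `d` the prover sees at most `4 * d` cells, whatever the
width (`le_depth_pow_four`). -/

/-- A coloured non-crossing matching of `ℤ`, together with an anchor and a set of covered cells.
Cells that are not covered are matched to themselves, and they are red to the left of the anchor
and blue to its right. A red pair may end immediately before the start of a blue pair only next to
the anchor. -/
structure Layout where
  mate : ℤ → ℤ
  red : ℤ → Bool
  anchor : ℤ
  cover : Set ℤ
  mate_mate : ∀ x, mate (mate x) = x
  red_mate : ∀ x, red (mate x) = red x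
  anchor_notMem : anchor ∉ cover
  mem_cover : ∀ x y, mate x ≠ x → x ≤ y → y ≤ mate x → y ∈ cover
  red_left : ∀ x, x ∉ cover → x < anchor → red x = true
  red_right : ∀ x, x ∉ cover → anchor < x → red x = false
  nesting : ∀ i j, i < j → j < mate i → mate i < mate j → False
  transition : ∀ i, mate i ≤ i → i + 1 ≤ mate (i + 1) → red i = true → red (i + 1) = false →
    i = anchor ∨ i + 1 = anchor

namespace Layout

/-- The two layouts put the same symbol on the cell `x`. -/
def SameAt (c d : Layout) (x : ℤ) : Prop := d.mate x = c.mate x ∧ d.red x = c.red x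

theorem SameAt.trans {c d e : Layout} {x : ℤ} (h : c.SameAt d x) (h' : d.SameAt e x) :
    c.SameAt e x := ⟨h'.1.trans h.1, h'.2.trans h.2⟩

theorem mate_eq_self (c : Layout) {x : ℤ} (hx : x ∉ c.cover) : c.mate x = x := by
  by_contra h
  rcases lt_or_gt_of_ne h with h' | h'
  · refine hx (c.mem_cover (c.mate x) x ?_ h'.le ?_)
    · rw [c.mate_mate]; exact fun e => h e.symm
    · rw [c.mate_mate]
  · exact hx (c.mem_cover x x h le_rfl h'.le)

/-! ### Elementary operations on layouts -/

/-- The layout without covered cells. -/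
def blank (f : ℤ) : Layout where
  mate x := x
  red x := decide (x < f)
  anchor := f
  cover := ∅
  mate_mate _ := rfl
  red_mate _ := rfl
  anchor_notMem := by simp
  mem_cover x y h := absurd rfl h
  red_left x _ h := by simpa using h
  red_right x _ h := by simpa using h.le
  nesting i j h h' := by omega
  transition i _ _ h h' := by
    simp only [decide_eq_true_eq, decide_eq_false_iff_not] at h h'
    omega

/-- The mirror image, with colours exchanged. -/
def reflect (c : Layout) : Layout where
  mate x := -c.mate (-x)
  red x := !c.red (-x)
  anchor := -c.anchor
  cover := {x | -x ∈ c.cover}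
  mate_mate x := by simp [c.mate_mate]
  red_mate x := by simp [c.red_mate]
  anchor_notMem := by simpa using c.anchor_notMem
  mem_cover x y h h₁ h₂ := by
    refine c.mem_cover (c.mate (-x)) (-y) ?_ (by omega) (by rw [c.mate_mate]; omega)
    rw [c.mate_mate]
    omega
  red_left x h h' := by
    simp [c.red_right (-x) h (by omega)]
  red_right x h h' := by
    simp [c.red_left (-x) h (by omega)]
  nesting i j h h₁ h₂ := by
    refine c.nesting (c.mate (-j)) (c.mate (-i)) (by omega) ?_ ?_ <;> simp only [c.mate_mate] <;>
      omega
  transition i h h₁ h₂ h₃ := by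
    have e : -(i + 1) + 1 = -i := by ring
    have := c.transition (-(i + 1)) (by omega) (by rw [e]; omega) (by simpa using h₃)
      (by rw [e]; simpa using h₂)
    omega

/-- Cover some more cells. -/
def addCover (c : Layout) (X : Set ℤ) (hX : c.anchor ∉ X) : Layout where
  __ := c
  cover := c.cover ∪ X
  anchor_notMem := by simpa [hX] using c.anchor_notMem
  mem_cover x y h h₁ h₂ := Or.inl (c.mem_cover x y h h₁ h₂)
  red_left x h h' := c.red_left x (fun hx => h (Or.inl hx)) h'
  red_right x h h' := c.red_right x (fun hx => h (Or.inl hx)) h'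

open Classical in
/-- Turn the covered cells outside `X` into trivial brackets. -/
noncomputable def keep (c : Layout) (X : Set ℤ) (hX : X ⊆ c.cover)
    (hsat : ∀ x y, c.mate x ≠ x → x ≤ y → y ≤ c.mate x → (x ∈ X ↔ y ∈ X))
    (hl : ∀ i, i ∈ X → i + 1 ∈ c.cover → i + 1 ∉ X → i + 1 ≤ c.anchor)
    (hr : ∀ i, i ∈ c.cover → i ∉ X → i + 1 ∈ X → c.anchor ≤ i) : Layout where
  mate x := if x ∈ c.cover ∧ x ∉ X then x else c.mate x
  red x := if x ∈ c.cover ∧ x ∉ X then decide (x < c.anchor) else c.red x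
  anchor := c.anchor
  cover := X
  mate_mate x := by
    by_cases h : x ∈ c.cover ∧ x ∉ X
    · simp [h]
    · have h' : ¬ (c.mate x ∈ c.cover ∧ c.mate x ∉ X) := by
        by_cases e : c.mate x = x
        · rwa [e]
        rcases lt_or_gt_of_ne e with l | l
        · have := hsat (c.mate x) x (by rw [c.mate_mate]; exact Ne.symm e) l.le
            (by rw [c.mate_mate])
          have := c.mem_cover (c.mate x) x (by rw [c.mate_mate]; exact Ne.symm e) l.le
            (by rw [c.mate_mate])
          tauto
        · have := hsat x (c.mate x) e l.le le_rfl
          have := c.mem_cover x x e le_rfl l.le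
          tauto
      simp only [h, h', if_false, c.mate_mate]
  red_mate x := by
    by_cases h : x ∈ c.cover ∧ x ∉ X
    · simp [h]
    · have h' : ¬ (c.mate x ∈ c.cover ∧ c.mate x ∉ X) := by
        by_cases e : c.mate x = x
        · rwa [e]
        rcases lt_or_gt_of_ne e with l | l
        · have := hsat (c.mate x) x (by rw [c.mate_mate]; exact Ne.symm e) l.le
            (by rw [c.mate_mate])
          have := c.mem_cover (c.mate x) x (by rw [c.mate_mate]; exact Ne.symm e) l.le
            (by rw [c.mate_mate])
          tauto
        · have := hsat x (c.mate x) e l.le le_rfl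
          have := c.mem_cover x x e le_rfl l.le
          tauto
      simp only [h, h', if_false, c.red_mate]
  anchor_notMem h := c.anchor_notMem (hX h)
  mem_cover x y h h₁ h₂ := by
    by_cases hx : x ∈ c.cover ∧ x ∉ X
    · simp [hx] at h
    · simp only [hx, if_false] at h h₂
      have := c.mem_cover x x h le_rfl (h₁.trans h₂)
      have := hsat x y h h₁ h₂
      tauto
  red_left x h h' := by
    by_cases hx : x ∈ c.cover
    · simp [hx, h, h']
    · simp [hx, c.red_left x hx h']
  red_right x h h' := by
    by_cases hx : x ∈ c.cover
    · simp [hx, h, h'.le]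
    · simp [hx, c.red_right x hx h']
  nesting i j h h₁ h₂ := by
    have := c.nesting i j h
    split_ifs at h₁ h₂ <;> first | omega | exact this h₁ h₂
  transition i h h₁ h₂ h₃ := by
    -- Only a border between an erased and a kept cell could create a new bad transition. There `hl`
    -- and `hr` put the erased cell on the side of the anchor where its colour is harmless.
    by_cases hi : i ∈ c.cover ∧ i ∉ X <;> by_cases hj : i + 1 ∈ c.cover ∧ i + 1 ∉ X
    · simp only [hi, hj, not_false_eq_true, and_self, if_true, decide_eq_true_eq,
        decide_eq_false_iff_not] at h₂ h₃
      omega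
    · simp only [hi, hj, not_false_eq_true, and_self, if_true, if_false, decide_eq_true_eq]
        at h₂ h₃
      by_cases hc : i + 1 ∈ X
      · have := hr i hi.1 hi.2 hc
        omega
      · have hc' : i + 1 ∉ c.cover := fun h => hj ⟨h, hc⟩
        by_contra hne
        have := c.red_left (i + 1) hc' (by omega)
        simp_all
    · simp only [hi, hj, not_false_eq_true, and_self, if_true, if_false,
        decide_eq_false_iff_not] at h₂ h₃
      by_cases hc : i ∈ X
      · have := hl i hc hj.1 hj.2
        omega
      · have hc' : i ∉ c.cover := fun h => hi ⟨h, hc⟩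
        by_contra hne
        have := c.red_right i hc' (by omega)
        simp_all
    · simp only [hi, hj, if_false] at h h₁ h₂ h₃
      exact c.transition i h h₁ h₂ h₃

/-- Move the anchor one cell to the left, over a cell that is not covered. -/
def stepLeft (c : Layout) (h : c.anchor - 1 ∉ c.cover) : Layout where
  mate := c.mate
  -- The old anchor is now an uncovered cell to the right of the new one, so it has to be blue.
  red := Function.update c.red c.anchor false
  anchor := c.anchor - 1
  cover := c.cover
  mate_mate := c.mate_mate
  red_mate x := by
    by_cases hx : x = c.anchor
    · rw [hx, c.mate_eq_self c.anchor_notMem]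
    · have : c.mate x ≠ c.anchor := by
        intro e
        rw [← c.mate_mate x, e, c.mate_eq_self c.anchor_notMem] at hx
        exact hx rfl
      simp [Function.update_of_ne, hx, this, c.red_mate]
  anchor_notMem := h
  mem_cover := c.mem_cover
  red_left x hx h := by
    rw [Function.update_of_ne (by omega)]
    exact c.red_left x hx (by omega)
  red_right x hx h := by
    by_cases e : x = c.anchor
    · simp [e]
    · rw [Function.update_of_ne e]
      exact c.red_right x hx (by omega)
  nesting := c.nesting
  transition i h₀ h₁ h₂ h₃ := by
    by_cases e : i = c.anchor
    · simp [e] at h₂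
    by_cases e' : i + 1 = c.anchor
    · omega
    rw [Function.update_of_ne e] at h₂
    rw [Function.update_of_ne e'] at h₃
    have := c.transition i h₀ h₁ h₂ h₃
    tauto

/-- Enclose the cells between `u` and the anchor in a blue pair, and put the anchor immediately
to the left of this pair. -/
def wrapLeft (c : Layout) (u : ℤ) (hlt : u < c.anchor) (hu : u ∉ c.cover)
    (hu' : u - 1 ∉ c.cover) : Layout where
  mate x := if x = u then c.anchor else if x = c.anchor then u else c.mate x
  red x := if x = u ∨ x = c.anchor then false else c.red x
  anchor := u - 1
  cover := c.cover ∪ Set.Icc u c.anchor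
  mate_mate x := by
    have hm : ∀ y, c.mate y = y → (c.mate x = y ↔ x = y) := fun y hy =>
      ⟨fun e => by rw [← c.mate_mate x, e, hy], fun e => by rw [e, hy]⟩
    have h₁ := hm u (c.mate_eq_self hu)
    have h₂ := hm c.anchor (c.mate_eq_self c.anchor_notMem)
    by_cases e : x = u
    · simp [e, hlt.ne']
    · by_cases e' : x = c.anchor
      · simp [e', hlt.ne']
      · simp [e, e', h₁, h₂, c.mate_mate]
  red_mate x := by
    have hm : ∀ y, c.mate y = y → (c.mate x = y ↔ x = y) := fun y hy =>
      ⟨fun e => by rw [← c.mate_mate x, e, hy], fun e => by rw [e, hy]⟩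
    have h₁ := hm u (c.mate_eq_self hu)
    have h₂ := hm c.anchor (c.mate_eq_self c.anchor_notMem)
    by_cases e : x = u
    · simp [e]
    · by_cases e' : x = c.anchor
      · simp [e', hlt.ne']
      · simp [e, e', h₁, h₂, c.red_mate]
  anchor_notMem := by simp [hu']
  mem_cover x y h h₁ h₂ := by
    by_cases e : x = u
    · simp only [e, if_true] at h₁ h₂
      exact Or.inr ⟨h₁, h₂⟩
    · by_cases e' : x = c.anchor
      · simp only [e', hlt.ne', if_true, if_false] at h₁ h₂
        omega
      · simp only [e, e', if_false] at h h₂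
        exact Or.inl (c.mem_cover x y h h₁ h₂)
  red_left x hx h := by
    have hx' : x ∉ c.cover := fun h => hx (Or.inl h)
    rw [if_neg (by omega)]
    exact c.red_left x hx' (by omega)
  red_right x hx h := by
    have hx' : x ∉ c.cover := fun h => hx (Or.inl h)
    have : ¬ (u ≤ x ∧ x ≤ c.anchor) := fun h => hx (Or.inr h)
    rw [if_neg (by omega)]
    exact c.red_right x hx' (by omega)
  nesting i j h h₁ h₂ := by
    -- An uncovered cell lies under no pair, so a new pair with ends `u` and `c.anchor` crosses
    -- nothing.
    have key : ∀ x y, y ∉ c.cover → x ≤ y → y ≤ c.mate x → x = y := by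
      intro x y hy h h'
      by_contra hne
      exact hy (c.mem_cover x y (by omega) h h')
    have ku : ∀ x, x ≤ u ∧ u ≤ c.mate x → x = u := fun x h => key x u hu h.1 h.2
    have kf : ∀ x, x ≤ c.anchor ∧ c.anchor ≤ c.mate x → x = c.anchor :=
      fun x h => key x c.anchor c.anchor_notMem h.1 h.2
    have mu := c.mate_eq_self hu
    have mf := c.mate_eq_self c.anchor_notMem
    have : ¬ (j < c.mate i ∧ c.mate i < c.mate j) := fun h' => c.nesting i j h h'.1 h'.2
    have := ku i
    have := ku j
    have := kf i
    have := kf j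
    have hm : ∀ x, (x = u → c.mate x = u) ∧ (x = c.anchor → c.mate x = c.anchor) :=
      fun x => ⟨fun e => e ▸ mu, fun e => by rw [e, mf]⟩
    have := hm i
    have := hm j
    split_ifs at h₁ h₂ <;> omega
  transition i h₀ h₁ h₂ h₃ := by
    by_cases e : i = u
    · simp [e] at h₂
    by_cases e' : i = c.anchor
    · simp [e'] at h₂
    by_cases e₂ : i + 1 = u
    · omega
    by_cases e₃ : i + 1 = c.anchor
    · simp only [e₃, hlt.ne', if_true, if_false] at h₁
      omega
    simp only [e, e', e₂, e₃, or_self, if_false] at h₀ h₁ h₂ h₃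
    have := c.transition i h₀ h₁ h₂ h₃
    tauto

/-! ### Moving the anchor -/

/-- The anchor can be moved to the left, to a cell `g` that is followed by another uncovered cell.
The runs of covered cells that it passes are enclosed in pairs, so the newly covered cells are
adjacent to covered cells. -/
theorem exists_moveLeft (n : ℕ) : ∀ (c : Layout) (g : ℤ), g ≤ c.anchor → c.anchor - g ≤ n →
    g ∉ c.cover → (g < c.anchor → g + 1 ∉ c.cover) →
    ∃ d : Layout, d.anchor = g ∧ (∀ x ∈ c.cover, x ∈ d.cover ∧ c.SameAt d x) ∧
      (∀ x, x < g ∨ c.anchor < x → c.SameAt d x) ∧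
      ∀ x ∈ d.cover, x ∈ c.cover ∨ (g ≤ x ∧ x ≤ c.anchor ∧
        ∃ y ∈ c.cover, g < y ∧ y < c.anchor ∧ (x = y + 1 ∨ y = x + 1)) := by
  induction n with
  | zero =>
    intro c g h h' _ _
    exact ⟨c, by omega, fun x hx => ⟨hx, rfl, rfl⟩, fun x _ => ⟨rfl, rfl⟩, fun x hx => Or.inl hx⟩
  | succ n ih =>
    intro c g h h' hg hg'
    by_cases e : g = c.anchor
    · exact ⟨c, e.symm, fun x hx => ⟨hx, rfl, rfl⟩, fun x _ => ⟨rfl, rfl⟩, fun x hx => Or.inl hx⟩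
    have hlt : g < c.anchor := by omega
    by_cases hf : c.anchor - 1 ∉ c.cover
    · obtain ⟨d, hd, hd₁, hd₂, hd₃⟩ := ih (c.stepLeft hf) g
        (by simp only [stepLeft]; omega) (by simp only [stepLeft]; push_cast at h'; omega) hg
        (fun _ => hg' hlt)
      have same : ∀ x, x ≠ c.anchor → c.SameAt (c.stepLeft hf) x := fun x hx =>
        ⟨rfl, Function.update_of_ne hx _ _⟩
      refine ⟨d, hd, fun x hx => ⟨(hd₁ x hx).1, ?_⟩, fun x hx => ?_, fun x hx => ?_⟩
      · exact (same x (fun e => c.anchor_notMem (e ▸ hx))).trans (hd₁ x hx).2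
      · exact (same x (by omega)).trans (hd₂ x (by simp only [stepLeft]; omega))
      · rcases hd₃ x hx with hx | ⟨h₁, h₂, y, hy, h₃, h₄, h₅⟩
        · exact Or.inl hx
        · simp only [stepLeft] at h₂ h₄
          exact Or.inr ⟨h₁, by omega, y, hy, h₃, by omega, h₅⟩
    · rw [not_not] at hf
      have hne : g + 1 ≠ c.anchor := fun e' => hg (by rwa [← e', add_sub_cancel_right] at hf)
      -- The nearest place for the left end of a pair: two adjacent uncovered cells, `u` for the
      -- bracket and `u - 1` for the anchor. The cell `g + 1` qualifies. By maximality, every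
      -- uncovered cell strictly between `u` and the anchor follows a covered one, so the pair newly
      -- covers only neighbours of covered cells.
      obtain ⟨u, ⟨hu₁, hu₂, hu₃⟩, hmax⟩ := Int.exists_greatest_of_bdd
        (P := fun u => u < c.anchor ∧ u ∉ c.cover ∧ u - 1 ∉ c.cover)
        ⟨c.anchor, fun z hz => hz.1.le⟩
        ⟨g + 1, by omega, hg' hlt, by rwa [add_sub_cancel_right]⟩
      have hgu : g + 1 ≤ u := hmax (g + 1) ⟨by omega, hg' hlt, by rwa [add_sub_cancel_right]⟩
      have hprev : ∀ x, u < x → x < c.anchor → x ∉ c.cover → x - 1 ∈ c.cover := by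
        intro x h₁ h₂ h₃
        by_contra h₄
        exact absurd (hmax x ⟨h₂, h₃, h₄⟩) (by omega)
      have hune : u ≠ c.anchor - 1 := fun e' => hu₂ (e' ▸ hf)
      have hnext : u + 1 ∈ c.cover := by
        by_contra h₃
        have := hprev (u + 1) (by omega) (by omega) h₃
        rw [add_sub_cancel_right] at this
        exact hu₂ this
      have same : ∀ x, x ≠ u → x ≠ c.anchor → c.SameAt (c.wrapLeft u hu₁ hu₂ hu₃) x :=
        fun x h₁ h₂ => ⟨by simp [wrapLeft, h₁, h₂], by simp [wrapLeft, h₁, h₂]⟩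
      have hcov : ∀ x ∈ (c.wrapLeft u hu₁ hu₂ hu₃).cover, x ∈ c.cover ∨ (u ≤ x ∧ x ≤ c.anchor ∧
          ∃ y ∈ c.cover, g < y ∧ y < c.anchor ∧ (x = y + 1 ∨ y = x + 1)) := by
        intro x hx
        by_cases hxc : x ∈ c.cover
        · exact Or.inl hxc
        obtain ⟨h₁, h₂⟩ := hx.resolve_left hxc
        refine Or.inr ⟨h₁, h₂, ?_⟩
        by_cases e₁ : x = u
        · exact ⟨u + 1, hnext, by omega, by omega, by omega⟩
        by_cases e₂ : x = c.anchor
        · exact ⟨c.anchor - 1, hf, by omega, by omega, by omega⟩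
        have := hprev x (by omega) (by omega) hxc
        have : x - 1 ≠ u := fun e' => hu₂ (e' ▸ this)
        exact ⟨x - 1, by assumption, by omega, by omega, by omega⟩
      obtain ⟨d, hd, hd₁, hd₂, hd₃⟩ := ih (c.wrapLeft u hu₁ hu₂ hu₃) g
        (by simp only [wrapLeft]; omega) (by simp only [wrapLeft]; push_cast at h'; omega)
        (by rintro (h | h)
            · exact hg h
            · exact absurd h.1 (by omega))
        (by rintro hl (h | h)
            · exact hg' hlt h
            · simp only [wrapLeft] at hl
              exact absurd h.1 (by omega))
      refine ⟨d, hd, fun x hx => ⟨(hd₁ x (Or.inl hx)).1, ?_⟩, fun x hx => ?_, fun x hx => ?_⟩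
      · exact (same x (fun e => hu₂ (e ▸ hx)) (fun e => c.anchor_notMem (e ▸ hx))).trans
          (hd₁ x (Or.inl hx)).2
      · exact (same x (by omega) (by omega)).trans (hd₂ x (by simp only [wrapLeft]; omega))
      · rcases hd₃ x hx with hx | ⟨h₁, h₂, y, hy, h₃, h₄, h₅⟩
        · rcases hcov x hx with hx | ⟨h₁, h₂, h₃⟩
          · exact Or.inl hx
          · exact Or.inr ⟨by omega, h₂, h₃⟩
        · simp only [wrapLeft] at h₂ h₄
          have hy' : y ∈ c.cover := hy.resolve_right (fun h => absurd h.1 (by omega))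
          exact Or.inr ⟨h₁, by omega, y, hy', h₃, by omega, h₅⟩

/-- The anchor can be moved to any cell `g` with uncovered neighbours. The newly covered cells are
adjacent to covered cells between the old and the new anchor. -/
theorem exists_move (c : Layout) (g : ℤ) (hg : g ∉ c.cover) (hg₁ : g + 1 ∉ c.cover)
    (hg₂ : g - 1 ∉ c.cover) :
    ∃ d : Layout, d.anchor = g ∧ (∀ x ∈ c.cover, x ∈ d.cover ∧ c.SameAt d x) ∧
      (∀ x, x ∉ Set.uIcc g c.anchor → c.SameAt d x) ∧
      ∀ x ∈ d.cover, x ∈ c.cover ∨ (x ∈ Set.uIcc g c.anchor ∧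
        ∃ y ∈ c.cover, y ∈ Set.uIcc g c.anchor ∧ (x = y + 1 ∨ y = x + 1)) := by
  rcases le_total g c.anchor with h | h
  · obtain ⟨d, hd, hd₁, hd₂, hd₃⟩ := exists_moveLeft (c.anchor - g).toNat c g h (by omega) hg
      (fun _ => hg₁)
    refine ⟨d, hd, hd₁, fun x hx => hd₂ x ?_, fun x hx => ?_⟩
    · rw [Set.uIcc_of_le h, Set.mem_Icc] at hx
      omega
    · rw [Set.uIcc_of_le h]
      rcases hd₃ x hx with hx | ⟨h₁, h₂, y, hy, h₃, h₄, h₅⟩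
      · exact Or.inl hx
      · exact Or.inr ⟨⟨h₁, h₂⟩, y, hy, ⟨h₃.le, h₄.le⟩, h₅⟩
  -- A move to the right is a move to the left in the mirror image; its new pairs are red.
  · obtain ⟨d, hd, hd₁, hd₂, hd₃⟩ := exists_moveLeft (g - c.anchor).toNat c.reflect (-g)
      (by simp only [reflect]; omega) (by simp only [reflect]; omega)
      (by simpa [reflect] using hg) (fun _ => by simpa [reflect, sub_eq_add_neg, add_comm] using hg₂)
    have same : ∀ x, c.reflect.SameAt d (-x) → c.SameAt d.reflect x := by
      rintro x ⟨h₁, h₂⟩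
      simp only [reflect, neg_neg] at h₁ h₂
      exact ⟨by simp only [reflect]; omega, by simp [reflect, h₂]⟩
    rw [Set.uIcc_of_ge h]
    refine ⟨d.reflect, by simp [reflect, hd], fun x hx => ?_, fun x hx => ?_, fun x hx => ?_⟩
    · have := hd₁ (-x) (by simpa [reflect] using hx)
      exact ⟨this.1, same x this.2⟩
    · rw [Set.mem_Icc] at hx
      exact same x (hd₂ (-x) (by simp only [reflect]; omega))
    · rcases hd₃ (-x) hx with hx | ⟨h₁, h₂, y, hy, h₃, h₄, h₅⟩
      · exact Or.inl (by simpa [reflect] using hx)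
      · simp only [reflect] at h₂ h₄
        exact Or.inr ⟨⟨by omega, by omega⟩, -y, hy, ⟨by omega, by omega⟩, by omega⟩

end Layout

end BracketFormula

namespace BracketFormula

/-! ### The adversary's game -/

/-- A run has only one right end: if two such ends led to the same cell of `S`, the path from the
larger would pass through the smaller, which is not in `U`. With its mirror image, this bounds the
cells that a move newly covers. -/
theorem card_le_of_right_boundary {U : Set ℤ} {S A : Finset ℤ}
    (h : ∀ x ∈ A, x ∉ U ∧ ∃ s ∈ S, ∀ y ∈ Set.uIcc (x - 1) s, y ∈ U) : A.card ≤ S.card := by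
  choose! hU f hf hy using h
  refine Finset.card_le_card_of_injOn f hf ?_
  have key : ∀ x ∈ A, ∀ y ∈ A, x < y → f x ≠ f y := by
    intro x hx y hy' hlt e
    have h₁ : f x ≤ x - 1 := by
      by_contra hc
      exact hU x hx (hy x hx x (Set.mem_uIcc.2 (by omega)))
    exact hU x hx (hy y hy' x (Set.mem_uIcc.2 (by omega)))
  intro x hx y hy' e
  rcases lt_trichotomy x y with h | h | h
  · exact absurd e (key x hx y hy' h)
  · exact h
  · exact absurd e.symm (key y hy' x hx h)

theorem card_le_of_left_boundary {U : Set ℤ} {S A : Finset ℤ}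
    (h : ∀ x ∈ A, x ∉ U ∧ ∃ s ∈ S, ∀ y ∈ Set.uIcc (x + 1) s, y ∈ U) : A.card ≤ S.card := by
  have := card_le_of_right_boundary (U := {x | -x ∈ U}) (S := S.image (- ·)) (A := A.image (- ·))
    (by
      intro x hx
      obtain ⟨z, hz, rfl⟩ := Finset.mem_image.1 hx
      obtain ⟨h₁, s, hs, h₂⟩ := h z hz
      refine ⟨by simpa using h₁, -s, Finset.mem_image_of_mem _ hs, fun y hy => h₂ (-y) ?_⟩
      rw [Set.mem_uIcc] at hy ⊢
      omega)
  rwa [Finset.card_image_of_injective _ neg_injective,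
    Finset.card_image_of_injective _ neg_injective] at this

/-! ### Relocating the anchor to an empty block -/

/-- The cells of the window of length `L` that starts at `a` which lie outside the blocks of
length `m` that start at `a`, `a + P`, `a + 2 * P`, … -/
noncomputable def margin (a L P m : ℤ) : Finset ℤ := {x ∈ Finset.Ico a (a + L) | m ≤ (x - a) % P}

theorem mem_margin {a L P m x : ℤ} : x ∈ margin a L P m ↔ (a ≤ x ∧ x < a + L) ∧ m ≤ (x - a) % P := by
  simp [margin]

theorem notMem_margin_of_mem_block {a L P m x b : ℤ} (hmP : m < P) (h : a + b * P ≤ x)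
    (h' : x < a + b * P + m) : x ∉ margin a L P m := by
  intro hx
  have e : x - a = (x - a - b * P) + P * b := by ring
  have := (mem_margin.1 hx).2
  rw [e, Int.add_mul_emod_self_left, Int.emod_eq_of_lt (by omega) (by omega)] at this
  omega

theorem mem_margin_of_between {a L P m x b : ℤ} (hm : 0 ≤ m) (h : a + b * P + m ≤ x)
    (h' : x < a + b * P + P) (hb : 0 ≤ b * P) (hL : b * P + P ≤ L) : x ∈ margin a L P m := by
  have e : x - a = (x - a - b * P) + P * b := by ring
  rw [mem_margin, e, Int.add_mul_emod_self_left, Int.emod_eq_of_lt (by omega) (by omega)]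
  omega

namespace Layout

open Classical in
/-- The number of covered cells of the margin. -/
noncomputable def marginCount (c : Layout) (a L P m : ℤ) : ℕ :=
  {x ∈ margin a L P m | x ∈ c.cover}.card

/-- If few cells of the margin of a window are covered, then the anchor can be moved to an empty
block of the window, covering few cells. -/
theorem exists_relocate (c : Layout) {w r : ℕ} {a L P m : ℤ} (hm : 3 ≤ m) (hL : (w + 1) * P ≤ L)
    (hP : r + w < P - m) (S : Finset ℤ) (hS : S.card ≤ w) (hfS : c.anchor ∉ S)
    (hf : c.anchor ∈ Set.Ico a (a + L))
    (hsep : ∀ x y, c.mate x ≠ x → x ≤ y → y ≤ c.mate x →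
      (x ∈ Set.Ico a (a + L) ↔ y ∈ Set.Ico a (a + L)))
    (hr : c.marginCount a L P m ≤ r) :
    ∃ (d : Layout) (b : ℕ), b ≤ w ∧ d.anchor ∈ Set.Ico (a + b * P) (a + b * P + m) ∧
      (∀ x ∈ Set.Ico (a + b * P) (a + b * P + m), x ∉ d.cover ∧ x ∉ S) ∧
      (∀ x ∈ S, c.SameAt d x) ∧
      (∀ x, x ∉ Set.Ico a (a + L) → c.SameAt d x ∧ (x ∈ d.cover ↔ x ∈ c.cover)) ∧
      d.marginCount a L P m ≤ r + 3 * w := by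
  classical
  have hmP : m < P := by omega
  have hP0 : 0 ≤ P := by omega
  have hbP : ∀ b : ℕ, b ≤ w → 0 ≤ (b : ℤ) * P ∧ (b : ℤ) * P + P ≤ L := by
    intro b hb
    have : ((b : ℤ) + 1) * P ≤ (w + 1) * P := mul_le_mul_of_nonneg_right (by omega) hP0
    exact ⟨by positivity, by linarith⟩
  set W : Set ℤ := Set.Ico a (a + L) with hW
  have hWc : ∀ x y z, x ∈ W → z ∈ W → y ∈ Set.uIcc x z → y ∈ W := by
    intro x y z hx hz hy
    rw [hW, Set.mem_Ico] at *
    rw [Set.mem_uIcc] at hy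
    omega
  -- Remembered trivial brackets are declared covered as well, so that moving the anchor cannot
  -- alter them.
  set c₁ : Layout := c.addCover {x | x ∈ S ∧ x ∈ W} (fun h => hfS h.1) with hc₁
  have c₁cov : ∀ x, x ∈ c₁.cover ↔ x ∈ c.cover ∨ (x ∈ S ∧ x ∈ W) := fun x => Iff.rfl
  set U : Set ℤ := {x | x ∈ c₁.cover ∧ x ∈ W} with hU
  set run : ℤ → Prop := fun x => ∃ s ∈ S, ∀ y ∈ Set.uIcc x s, y ∈ U with hrun
  -- Inside the window only runs that contain a remembered cell are kept; outside it everything is.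
  set X : Set ℤ := {x | x ∈ c₁.cover ∧ (x ∈ W → run x)} with hX
  have run_of_path : ∀ x y, (∀ z ∈ Set.uIcc x y, z ∈ U) → run x → run y := by
    rintro x y hxy ⟨s, hs, h⟩
    refine ⟨s, hs, fun z hz => ?_⟩
    rcases Set.uIcc_subset_uIcc_union_uIcc (b := x) hz with h' | h'
    · exact hxy z (by rwa [Set.uIcc_comm])
    · exact h z h'
  have run_adj : ∀ x y, x ∈ U → y ∈ U → (x = y + 1 ∨ y = x + 1) → run x → run y := by
    intro x y hx hy h
    refine run_of_path x y fun z hz => ?_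
    have : z = x ∨ z = y := by
      rw [Set.mem_uIcc] at hz
      omega
    rcases this with rfl | rfl <;> assumption
  have hsat : ∀ x y, c₁.mate x ≠ x → x ≤ y → y ≤ c₁.mate x → (x ∈ X ↔ y ∈ X) := by
    intro x y h h₁ h₂
    have hcov : ∀ z, x ≤ z → z ≤ c₁.mate x → z ∈ c₁.cover := fun z => c₁.mem_cover x z h
    have hw : ∀ z, x ≤ z → z ≤ c₁.mate x → (x ∈ W ↔ z ∈ W) := fun z => hsep x z h
    have hpath : x ∈ W → ∀ z ∈ Set.uIcc x y, z ∈ U := by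
      intro hx z hz
      rw [Set.uIcc_of_le h₁, Set.mem_Icc] at hz
      exact ⟨hcov z hz.1 (by omega), (hw z hz.1 (by omega)).1 hx⟩
    have e₁ := hcov x le_rfl (h₁.trans h₂)
    have e₂ := hcov y h₁ h₂
    have e₃ := hw y h₁ h₂
    constructor
    · rintro ⟨-, h₄⟩
      exact ⟨e₂, fun hy => run_of_path x y (hpath (e₃.2 hy)) (h₄ (e₃.2 hy))⟩
    · rintro ⟨-, h₄⟩
      exact ⟨e₁, fun hx => run_of_path y x (by rw [Set.uIcc_comm]; exact hpath hx) (h₄ (e₃.1 hx))⟩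
  have hl : ∀ i, i ∈ X → i + 1 ∈ c₁.cover → i + 1 ∉ X → i + 1 ≤ c₁.anchor := by
    intro i hi h h'
    have hiW : i + 1 ∈ W := by
      by_contra hc
      exact h' ⟨h, fun hW => absurd hW hc⟩
    by_cases hi' : i ∈ W
    · exact absurd ⟨h, fun _ => run_adj i (i + 1) ⟨hi.1, hi'⟩ ⟨h, hiW⟩ (Or.inr rfl) (hi.2 hi')⟩ h'
    -- Kept and erased cells can be adjacent only at an end of the window, and the anchor is inside
    -- the window.
    · have : c₁.anchor = c.anchor := rfl
      simp only [hW, Set.mem_Ico] at hi' hiW hf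
      omega
  have hr' : ∀ i, i ∈ c₁.cover → i ∉ X → i + 1 ∈ X → c₁.anchor ≤ i := by
    intro i h h' hi
    have hiW : i ∈ W := by
      by_contra hc
      exact h' ⟨h, fun hW => absurd hW hc⟩
    by_cases hi' : i + 1 ∈ W
    · exact absurd ⟨h, fun _ => run_adj (i + 1) i ⟨hi.1, hi'⟩ ⟨h, hiW⟩ (Or.inl rfl) (hi.2 hi')⟩ h'
    · have : c₁.anchor = c.anchor := rfl
      simp only [hW, Set.mem_Ico] at hi' hiW hf
      omega
  set c₂ : Layout := c₁.keep X (fun x hx => hx.1) hsat hl hr' with hc₂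
  have hSX : ∀ x ∈ S, x ∈ W → x ∈ X := by
    intro x hx hxW
    have hx₁ : x ∈ c₁.cover := Or.inr ⟨hx, hxW⟩
    refine ⟨hx₁, fun _ => ⟨x, hx, fun y hy => ?_⟩⟩
    rw [Set.uIcc_self, Set.mem_singleton_iff] at hy
    exact hy ▸ ⟨hx₁, hxW⟩
  have same₂ : ∀ x, x ∈ X ∨ x ∉ W → c.SameAt c₂ x := by
    intro x hx
    have : ¬ (x ∈ c₁.cover ∧ x ∉ X) := by
      rintro ⟨h₁, h₂⟩
      exact h₂ ⟨h₁, fun hxW => absurd hxW (hx.resolve_left h₂)⟩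
    exact ⟨by simp only [hc₂, keep, this, if_false]; rfl,
      by simp only [hc₂, keep, this, if_false]; rfl⟩
  have hXc : ∀ x, x ∈ X → x ∈ c.cover ∨ x ∈ S := fun x hx => hx.1.imp id And.left
  -- Pigeonhole: if each of the `w + 1` blocks met or touched a kept run, two blocks would lead to
  -- the same remembered cell. Then the whole gap between them, at least `P - m` cells, would be
  -- covered, which `hr` and `hP` exclude.
  have hblock : ∃ b : ℕ, b ≤ w ∧ ∀ x ∈ Set.Ico (a + b * P) (a + b * P + m),
      ∀ y, y ∈ X → y ∈ W → (x = y ∨ x = y + 1 ∨ y = x + 1) → False := by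
    by_contra hc
    push Not at hc
    have hc' : ∀ b ∈ Finset.range (w + 1), ∃ y s, s ∈ S ∧ (∀ z ∈ Set.uIcc y s, z ∈ U) ∧
        a + b * P - 1 ≤ y ∧ y ≤ a + b * P + m := by
      intro b hb
      obtain ⟨x, hx, y, hy, hyW, h, -⟩ := hc b (by simpa [Nat.lt_succ_iff] using hb)
      obtain ⟨s, hs, h'⟩ := hy.2 hyW
      rw [Set.mem_Ico] at hx
      exact ⟨y, s, hs, h', by omega, by omega⟩
    choose! y s hs hpath hy₁ hy₂ using hc'
    obtain ⟨b, hb, b', hb', hne, e⟩ := Finset.exists_ne_map_eq_of_card_lt_of_maps_to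
      (s := Finset.range (w + 1)) (t := S) (by simpa [Nat.lt_succ_iff] using hS) hs
    have key : ∀ b ∈ Finset.range (w + 1), ∀ b' ∈ Finset.range (w + 1), b < b' →
        s b ≠ s b' := by
      intro b hb b' hb' hlt e
      rw [Finset.mem_range] at *
      have hbb := hbP b (by omega)
      have hstep : (b : ℤ) * P + P ≤ b' * P := by
        have : ((b : ℤ) + 1) * P ≤ b' * P := mul_le_mul_of_nonneg_right (by omega) hP0
        linarith
      have hsub : Finset.Ico (a + b * P + m) (a + b * P + P) ⊆
          {x ∈ margin a L P m | x ∈ c.cover} ∪ S := by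
        intro x hx
        rw [Finset.mem_Ico] at hx
        have h₁ := hy₂ b (Finset.mem_range.2 hb)
        have h₂ := hy₁ b' (Finset.mem_range.2 hb')
        have hxU : x ∈ U := by
          have hx' : x ∈ Set.uIcc (y b) (y b') := Set.mem_uIcc.2 (by omega)
          rcases Set.uIcc_subset_uIcc_union_uIcc (b := s b) hx' with h | h
          · exact hpath b (Finset.mem_range.2 hb) x h
          · rw [Set.uIcc_comm, e] at h
            exact hpath b' (Finset.mem_range.2 hb') x h
        rw [Finset.mem_union, Finset.mem_filter]
        rcases hxU.1 with h | h
        · exact Or.inl ⟨mem_margin_of_between (by omega) hx.1 hx.2 hbb.1 hbb.2, h⟩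
        · exact Or.inr h.1
      have h₁ := Finset.card_le_card hsub
      have h₂ := Finset.card_union_le {x ∈ margin a L P m | x ∈ c.cover} S
      rw [Int.card_Ico] at h₁
      unfold marginCount at hr
      omega
    rcases lt_or_gt_of_ne hne with h | h
    · exact key b hb b' hb' h e
    · exact key b' hb' b hb h e.symm
  obtain ⟨b, hb, hfree⟩ := hblock
  have hbb := hbP b hb
  have hbW : ∀ x ∈ Set.Ico (a + b * P) (a + b * P + m), x ∈ W := by
    intro x hx
    rw [Set.mem_Ico] at hx
    exact ⟨by omega, by omega⟩
  have hbX : ∀ x ∈ Set.Ico (a + b * P) (a + b * P + m), x ∉ X := fun x hx h =>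
    hfree x hx x h (hbW x hx) (Or.inl rfl)
  -- The offset `1` keeps both neighbours of the new anchor inside the block, as `3 ≤ m`.
  obtain ⟨d, hd, hd₁, hd₂, hd₃⟩ := c₂.exists_move (a + b * P + 1)
    (hbX _ ⟨by omega, by omega⟩) (hbX _ ⟨by omega, by omega⟩) (hbX _ ⟨by omega, by omega⟩)
  have hgf : ∀ x ∈ Set.uIcc (a + b * P + 1) c₂.anchor, x ∈ W := fun x hx =>
    hWc _ x _ (hbW _ ⟨by omega, by omega⟩) hf hx
  refine ⟨d, b, hb, ?_, fun x hx => ⟨fun h => ?_, fun h => ?_⟩, fun x hx => ?_, fun x hx =>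
    ⟨(same₂ x (Or.inr hx)).trans (hd₂ x fun h => hx (hgf x h)), fun h => ?_, fun h => ?_⟩, ?_⟩
  · rw [hd, Set.mem_Ico]
    omega
  · rcases hd₃ x h with h | ⟨h₁, y, h₂, h₃, h₄⟩
    · exact hbX x hx h
    · exact hfree x hx y h₂ (hgf y h₃) (Or.inr h₄)
  · exact hbX x hx (hSX x h (hbW x hx))
  · by_cases hxW : x ∈ W
    · exact (same₂ x (Or.inl (hSX x hx hxW))).trans (hd₁ x (hSX x hx hxW)).2
    · exact (same₂ x (Or.inr hxW)).trans (hd₂ x fun h => hxW (hgf x h))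
  · rcases hd₃ x h with h | ⟨h₁, -⟩
    · exact h.1.resolve_right fun h => hx h.2
    · exact absurd (hgf x h₁) hx
  · exact (hd₁ x ⟨Or.inl h, fun hxW => absurd hxW hx⟩).1
  · set A : Finset ℤ := {x ∈ margin a L P m | x ∉ U ∧ x - 1 ∈ U ∧ run (x - 1)} with hA
    set B : Finset ℤ := {x ∈ margin a L P m | x ∉ U ∧ x + 1 ∈ U ∧ run (x + 1)} with hB
    -- The cost `3 * w`: remembered cells, right ends and left ends of kept runs, at most `w` of
    -- each.
    have hsub : ({x ∈ margin a L P m | x ∈ d.cover} : Finset ℤ) ⊆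
        (({x ∈ margin a L P m | x ∈ c.cover} ∪ S) ∪ A) ∪ B := by
      intro x hx
      rw [Finset.mem_filter] at hx
      simp only [Finset.mem_union, Finset.mem_filter, hA, hB, hx.1, true_and]
      by_cases hxX : x ∈ X
      · exact Or.inl (Or.inl (hXc x hxX))
      rcases hd₃ x hx.2 with h | ⟨h₁, y, h₂, h₃, h₄⟩
      · exact absurd h hxX
      have hyU : y ∈ U := ⟨h₂.1, hgf y h₃⟩
      have hyr : run y := h₂.2 hyU.2
      have hxU : x ∉ U := fun hxU =>
        hxX ⟨hxU.1, fun _ => run_adj y x hyU hxU (by tauto) hyr⟩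
      rcases h₄ with rfl | rfl
      · exact Or.inl (Or.inr ⟨hxU, by rwa [add_sub_cancel_right], by rwa [add_sub_cancel_right]⟩)
      · exact Or.inr ⟨hxU, hyU, hyr⟩
    have hAc : A.card ≤ S.card := card_le_of_right_boundary (U := U) fun x hx => by
      rw [hA, Finset.mem_filter] at hx
      exact ⟨hx.2.1, hx.2.2.2⟩
    have hBc : B.card ≤ S.card := card_le_of_left_boundary (U := U) fun x hx => by
      rw [hB, Finset.mem_filter] at hx
      exact ⟨hx.2.1, hx.2.2.2⟩
    have h₁ := Finset.card_le_card hsub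
    have h₂ := Finset.card_union_le (({x ∈ margin a L P m | x ∈ c.cover} ∪ S) ∪ A) B
    have h₃ := Finset.card_union_le ({x ∈ margin a L P m | x ∈ c.cover} ∪ S) A
    have h₄ := Finset.card_union_le {x ∈ margin a L P m | x ∈ c.cover} S
    unfold marginCount at hr ⊢
    omega

/-- Only cells of `[0, N)` are covered, and the anchor is one of these cells. -/
def Confined (N : ℤ) (c : Layout) : Prop :=
  c.anchor ∈ Set.Ico 0 N ∧ ∀ x ∈ c.cover, x ∈ Set.Ico 0 N

end Layout

/-! ### The game and its composition -/

/-- The adversary can answer `t` rounds of queries, of four cells each, to a prover who remembers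
the symbols on at most `w` cells at a time, without exposing the anchor; afterwards `Q` holds. -/
def Survives (N : ℤ) (w : ℕ) (Q : Finset ℤ → Layout → Prop) : ℕ → Finset ℤ → Layout → Prop
  | 0, S, c => Q S c
  | t + 1, S, c => ∀ Z : Finset ℤ, Z.card ≤ 4 → ∃ d : Layout, (∀ x ∈ S, c.SameAt d x) ∧
      d.Confined N ∧ d.anchor ∉ S ∪ Z ∧
      ∀ S' ⊆ S ∪ Z, S'.card ≤ w → Survives N w Q t S' d

namespace Survives

variable {N : ℤ} {w : ℕ} {Q Q' : Finset ℤ → Layout → Prop}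

theorem mono (hQ : ∀ S c, Q S c → Q' S c) {t : ℕ} : ∀ {S : Finset ℤ} {c : Layout},
    Survives N w Q t S c → Survives N w Q' t S c := by
  induction t with
  | zero => exact fun h => hQ _ _ h
  | succ t ih =>
    intro S c h Z hZ
    obtain ⟨d, h₁, h₂, h₃, h₄⟩ := h Z hZ
    exact ⟨d, h₁, h₂, h₃, fun S' hS' hc => ih (h₄ S' hS' hc)⟩

theorem comp {t u : ℕ} : ∀ {S : Finset ℤ} {c : Layout},
    Survives N w (Survives N w Q u) t S c → Survives N w Q (u + t) S c := by
  induction t with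
  | zero => exact fun h => h
  | succ t ih =>
    intro S c h Z hZ
    obtain ⟨d, h₁, h₂, h₃, h₄⟩ := h Z hZ
    exact ⟨d, h₁, h₂, h₃, fun S' hS' hc => ih (h₄ S' hS' hc)⟩

/-- The adversary commits only to the remembered cells, so it may switch layouts before the next
query. With no rounds left, `Q` would concern the layout itself, hence `0 < t`. -/
theorem congr {t : ℕ} (ht : 0 < t) {S : Finset ℤ} {c d : Layout} (hcd : ∀ x ∈ S, c.SameAt d x)
    (h : Survives N w Q t S d) : Survives N w Q t S c := by
  obtain ⟨t, rfl⟩ : ∃ u, t = u + 1 := ⟨t - 1, by omega⟩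
  intro Z hZ
  obtain ⟨e, h₁, h₂, h₃, h₄⟩ := h Z hZ
  exact ⟨e, fun x hx => (hcd x hx).trans (h₁ x hx), h₂, h₃, h₄⟩

end Survives

/-! ### Recursive play in nested windows -/

/-- The layout `d` differs from `c` only in the window `[a, b)`, where its anchor lies, and the
prover remembers `S`. -/
def Within (w : ℕ) (a b : ℤ) (c : Layout) (S : Finset ℤ) (d : Layout) : Prop :=
  S.card ≤ w ∧ d.anchor ∈ Set.Ico a b ∧ d.anchor ∉ S ∧
    ∀ x, x ∉ Set.Ico a b → c.SameAt d x ∧ (x ∈ d.cover ↔ x ∈ c.cover)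

/-- The length of the windows of level `k`. -/
def windowLength (w k : ℕ) : ℕ := 7 * (10 * w ^ 2) ^ k

/-- The number of rounds that can be played in a window of level `k`. -/
def rounds (w : ℕ) : ℕ → ℕ
  | 0 => 1
  | k + 1 => windowLength w k * rounds w k

theorem rounds_pos {w : ℕ} (hw : 1 ≤ w) (k : ℕ) : 0 < rounds w k := by
  induction k with
  | zero => exact one_pos
  | succ k ih => exact Nat.mul_pos (by unfold windowLength; positivity) ih

theorem Within.confined {N a b : ℤ} {w : ℕ} {c d : Layout} {S : Finset ℤ}
    (h : Within w a b c S d) (hc : c.Confined N) (ha : 0 ≤ a) (hb : b ≤ N) : d.Confined N := by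
  obtain ⟨-, hf, -, hx⟩ := h
  rw [Set.mem_Ico] at hf
  refine ⟨⟨by omega, by omega⟩, fun x hxd => ?_⟩
  by_cases hxW : x ∈ Set.Ico a b
  · rw [Set.mem_Ico] at hxW
    exact ⟨by omega, by omega⟩
  · exact hc.2 x (((hx x hxW).2).1 hxd)

/-- A pair of `d` across the border of the window would have an end outside, where `d` agrees with
`c`; so it would be a pair of `c` covering a cell of the window. -/
theorem Within.separated {a b : ℤ} {w : ℕ} {c d : Layout} {S : Finset ℤ}
    (h : Within w a b c S d) (hfree : ∀ x ∈ Set.Ico a b, x ∉ c.cover) (x y : ℤ)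
    (hne : d.mate x ≠ x) (h₁ : x ≤ y) (h₂ : y ≤ d.mate x) :
    x ∈ Set.Ico a b ↔ y ∈ Set.Ico a b := by
  constructor
  · intro hx
    by_contra hy
    have hm : d.mate x ∉ Set.Ico a b := by
      rw [Set.mem_Ico] at *
      omega
    have e : c.mate (d.mate x) = x := by
      rw [← (h.2.2.2 _ hm).1.1, d.mate_mate]
    refine hfree x hx (c.mem_cover x x ?_ le_rfl ?_)
    · rw [← e, c.mate_mate, e]
      exact hne
    · rw [← e, c.mate_mate, e]
      exact h₁.trans h₂
  · intro hy
    by_contra hx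
    rw [(h.2.2.2 x hx).1.1] at hne h₂
    exact hfree y hy (c.mem_cover x y hne h₁ h₂)

/-- In an empty window the adversary can play, without changing the layout elsewhere. -/
theorem survives_window {N : ℤ} {w : ℕ} (hw : 1 ≤ w) (k : ℕ) : ∀ (c : Layout) (S : Finset ℤ)
    (a : ℤ), c.Confined N → S.card ≤ w → 0 ≤ a → a + windowLength w k ≤ N →
    c.anchor ∈ Set.Ico a (a + windowLength w k) →
    (∀ x ∈ Set.Ico a (a + windowLength w k), x ∉ c.cover ∧ x ∉ S) →
    Survives N w (Within w a (a + windowLength w k) c) (rounds w k) S c := by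
  induction k with
  | zero =>
    intro c S a hc hS ha hN hf hfree
    have e : (windowLength w 0 : ℤ) = 7 := by simp [windowLength]
    rw [e] at hN hf hfree ⊢
    intro Z hZ
    -- Five candidates against four queried cells; the two outer cells of the window supply the
    -- uncovered neighbours. This is the reason for the length `7`.
    obtain ⟨g, hg, hgZ⟩ : ∃ g ∈ Finset.Ico (a + 1) (a + 6), g ∉ Z := by
      by_contra! h
      have := Finset.card_le_card (s := Finset.Ico (a + 1) (a + 6)) (t := Z) h
      rw [Int.card_Ico] at this
      omega
    rw [Finset.mem_Ico] at hg
    obtain ⟨d, hd, hd₁, hd₂, hd₃⟩ := c.exists_move g (hfree _ ⟨by omega, by omega⟩).1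
      (hfree _ ⟨by omega, by omega⟩).1 (hfree _ ⟨by omega, by omega⟩).1
    have hgf : ∀ x ∈ Set.uIcc g c.anchor, x ∈ Set.Ico a (a + 7) := by
      intro x hx
      rw [Set.mem_uIcc] at hx
      rw [Set.mem_Ico] at *
      omega
    have hwithin : ∀ S' ⊆ S ∪ Z, S'.card ≤ w → Within w a (a + 7) c S' d := by
      refine fun S' hS' hc' => ⟨hc', by rw [hd]; exact ⟨by omega, by omega⟩, fun h => ?_,
        fun x hx => ⟨hd₂ x fun h => hx (hgf x h), fun h => ?_, fun h => (hd₁ x h).1⟩⟩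
      · rw [hd] at h
        rcases Finset.mem_union.1 (hS' h) with h | h
        · exact (hfree g ⟨by omega, by omega⟩).2 h
        · exact hgZ h
      · rcases hd₃ x h with h | ⟨h, -⟩
        · exact h
        · exact absurd (hgf x h) hx
    refine ⟨d, fun x hx => hd₂ x fun h => (hfree x (hgf x h)).2 hx, ?_, ?_, hwithin⟩
    · exact (hwithin S Finset.subset_union_left hS).confined hc ha hN
    · rw [hd, Finset.mem_union, not_or]
      exact ⟨(hfree g ⟨by omega, by omega⟩).2, hgZ⟩
  | succ k ih =>
    classical
    intro c S a hc hS ha hN hf hfree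
    set m : ℤ := ((windowLength w k : ℕ) : ℤ) with hm
    set L : ℤ := ((windowLength w (k + 1) : ℕ) : ℤ) with hL
    -- The window has length `2 * w * P`, enough for `w + 1` blocks. Before each of the `m` phases
    -- at most `3 * w * (m - 1)` margin cells are covered, and adding `w` stays below the gap `P -
    -- m`.
    set P : ℤ := 5 * w * m with hP
    have hw' : (1 : ℤ) ≤ w := by exact_mod_cast hw
    have hm7 : 7 ≤ m := by
      have : 1 ≤ (10 * w ^ 2) ^ k := Nat.one_le_pow _ _ (by positivity)
      simp only [hm, windowLength]
      omega
    have hLm : L = 10 * w ^ 2 * m := by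
      simp only [hL, hm, windowLength]
      push_cast
      ring
    have hPL : (w + 1) * P ≤ L := by
      rw [hLm, hP]
      nlinarith [mul_nonneg (mul_nonneg (by omega : (0 : ℤ) ≤ w - 1) (by omega : (0 : ℤ) ≤ w))
        (by omega : (0 : ℤ) ≤ m)]
    have hP0 : 0 ≤ P := by positivity
    let good : ℕ → Finset ℤ → Layout → Prop := fun j S' d =>
      Within w a (a + L) c S' d ∧ d.marginCount a L P m ≤ 3 * w * j
    have step : ∀ j : ℕ, j < windowLength w k → ∀ S' d, good j S' d →
        Survives N w (good (j + 1)) (rounds w k) S' d := by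
      rintro j hj S' d ⟨hd, hcount⟩
      have hdc := hd.confined hc ha hN
      obtain ⟨e, b, hb, he, hefree, hsame, hout, hecount⟩ := d.exists_relocate
        (r := 3 * w * j) (by omega) hPL (by
          have : (j : ℤ) + 1 ≤ m := by rw [hm]; exact_mod_cast hj
          push_cast
          rw [hP]
          nlinarith [mul_le_mul_of_nonneg_left this (by omega : (0 : ℤ) ≤ w)])
        S' hd.1 hd.2.2.1 hd.2.1 (hd.separated fun x hx => (hfree x hx).1) hcount
      have hbL : 0 ≤ (b : ℤ) * P ∧ (b : ℤ) * P + P ≤ L := by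
        have : ((b : ℤ) + 1) * P ≤ (w + 1) * P := mul_le_mul_of_nonneg_right (by omega) hP0
        exact ⟨by positivity, by linarith⟩
      have hmP : m < P := by
        rw [hP]
        nlinarith
      have hsub : ∀ x, x ∉ Set.Ico a (a + L) → x ∉ Set.Ico (a + b * P) (a + b * P + m) := by
        intro x hx
        rw [Set.mem_Ico] at *
        omega
      have hwin : Within w a (a + L) c S' e := by
        refine ⟨hd.1, ?_, (hefree _ he).2, fun x hx =>
          ⟨(hd.2.2.2 x hx).1.trans (hout x hx).1, (hout x hx).2.trans (hd.2.2.2 x hx).2⟩⟩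
        rw [Set.mem_Ico] at *
        omega
      refine Survives.congr (rounds_pos hw k) hsame ?_
      refine (ih e S' (a + b * P) (hwin.confined hc ha hN) hd.1 (by omega) (by omega) he
        hefree).mono ?_
      rintro S'' d' hd'
      refine ⟨⟨hd'.1, ?_, hd'.2.2.1, fun x hx => ?_⟩, ?_⟩
      · have := hd'.2.1
        rw [Set.mem_Ico] at *
        omega
      · have h₁ := hwin.2.2.2 x hx
        have h₂ := hd'.2.2.2 x (hsub x hx)
        exact ⟨h₁.1.trans h₂.1, h₂.2.trans h₁.2⟩
      -- The recursive game changes covers only inside its block, which is disjoint from the margin,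
      -- so only relocations add to the count.
      · have : d'.marginCount a L P m = e.marginCount a L P m := by
          unfold Layout.marginCount
          congr 1
          refine Finset.filter_congr fun x hx => (hd'.2.2.2 x fun hx' => ?_).2
          rw [Set.mem_Ico] at hx'
          exact notMem_margin_of_mem_block hmP hx'.1 hx'.2 hx
        rw [this]
        linarith
    have main : ∀ j : ℕ, j ≤ windowLength w k →
        Survives N w (good j) (j * rounds w k) S c := by
      intro j
      induction j with
      | zero =>
        intro _
        rw [zero_mul]
        refine ⟨⟨hS, hf, (hfree _ hf).2, fun x _ => ⟨⟨rfl, rfl⟩, Iff.rfl⟩⟩, ?_⟩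
        rw [mul_zero, Nat.le_zero, Layout.marginCount, Finset.card_eq_zero,
          Finset.filter_eq_empty_iff]
        intro x hx
        exact (hfree x (mem_margin.1 hx).1).1
      | succ j ihj =>
        intro hj
        rw [Nat.succ_mul, add_comm (j * _)]
        exact ((ihj (by omega)).mono (step j (by omega))).comp
    exact (main _ le_rfl).mono fun _ _ h => h.1

theorem survives_blank {w k n : ℕ} (hw : 1 ≤ w) (hn : windowLength w k ≤ n) :
    Survives n w (fun _ _ => True) (rounds w k) ∅ (Layout.blank 0) := by
  have h0 : 0 < windowLength w k := by unfold windowLength; positivity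
  refine (survives_window hw k (Layout.blank 0) ∅ 0 ⟨⟨le_rfl, ?_⟩, ?_⟩ (by simp) le_rfl ?_ ?_
    ?_).mono fun _ _ _ => trivial
  · simp only [Layout.blank]
    omega
  · simp [Layout.blank]
  · omega
  · simp only [Layout.blank, Set.mem_Ico]
    omega
  · simp [Layout.blank]

end BracketFormula

namespace BracketFormula

/-! ### Layouts as strings -/

namespace Layout

variable {n : ℕ}

/-- The symbol that the layout puts on the cell `i`. -/
noncomputable def symbol (c : Layout) (i : Fin n) : Symbol n :=
  ((if c.red (i : ℕ) then .red else .blue,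
    if c.mate (i : ℕ) = (i : ℕ) then .trivial
      else if ((i : ℕ) : ℤ) < c.mate (i : ℕ) then .opening else .closing),
    -- The default `i` is never taken for a confined layout, by `Confined.mate_mem`.
    if h : 0 ≤ c.mate (i : ℕ) ∧ c.mate (i : ℕ) < n then
      ⟨(c.mate (i : ℕ)).toNat, by omega⟩ else i)

theorem SameAt.symbol_eq {c d : Layout} {i : Fin n} (h : c.SameAt d (i : ℕ)) :
    d.symbol i = c.symbol i := by
  unfold symbol
  simp only [h.1, h.2]

variable (c : Layout) (i : Fin n)

theorem colour_eq_red : (c.symbol i).colour = .red ↔ c.red (i : ℕ) = true := by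
  unfold symbol Symbol.colour
  split_ifs <;> simp_all

theorem colour_eq_blue : (c.symbol i).colour = .blue ↔ c.red (i : ℕ) = false := by
  unfold symbol Symbol.colour
  split_ifs <;> simp_all

theorem shape_eq_trivial : (c.symbol i).shape = .trivial ↔ c.mate (i : ℕ) = (i : ℕ) := by
  unfold symbol Symbol.shape
  split_ifs <;> simp_all

theorem shape_eq_opening : (c.symbol i).shape = .opening ↔ ((i : ℕ) : ℤ) < c.mate (i : ℕ) := by
  unfold symbol Symbol.shape
  split_ifs <;> simp_all

theorem shape_eq_closing : (c.symbol i).shape = .closing ↔ c.mate (i : ℕ) < (i : ℕ) := by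
  have h₁ := c.shape_eq_trivial i
  have h₂ := c.shape_eq_opening i
  cases h : (c.symbol i).shape <;> simp only [h, reduceCtorEq, true_iff, false_iff] at * <;> omega

variable {c}

theorem Confined.mate_mem (hc : c.Confined n) : 0 ≤ c.mate (i : ℕ) ∧ c.mate (i : ℕ) < n := by
  by_contra h
  have h' : c.mate (i : ℕ) ∉ c.cover := fun hx => h (hc.2 _ hx)
  have := c.mate_eq_self h'
  rw [c.mate_mate] at this
  omega

theorem Confined.pointer_eq (hc : c.Confined n) (j : Fin n) :
    (c.symbol i).pointer = j ↔ c.mate (i : ℕ) = (j : ℕ) := by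
  have := hc.mate_mem i
  unfold symbol Symbol.pointer
  rw [dif_pos this, Fin.ext_iff]
  simp only
  omega

/-- A layout satisfies every axiom that does not mention the anchor. -/
theorem Confined.holds (hc : c.Confined n) {C : Constraint n} (hC : IsAxiom C)
    (hf : ∀ i ∈ C.indices, ((i : ℕ) : ℤ) ≠ c.anchor) : C.holds c.symbol := by
  have hfr := hc.1
  rw [Set.mem_Ico] at hfr
  have out : ∀ x : ℤ, x < 0 ∨ n ≤ x → x ∉ c.cover := fun x hx hx' => by
    have := hc.2 x hx'
    rw [Set.mem_Ico] at this
    omega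
  cases hC with
  | start i hi =>
    have hne := hf i (Finset.mem_singleton_self i)
    have hm := hc.mate_mem i
    simp only [colour_eq_red, shape_eq_trivial, shape_eq_opening]
    refine ⟨?_, by omega⟩
    -- The cell `-1` is uncovered and red, so a blue first cell would be a bad transition away from
    -- the anchor. The last cell is handled symmetrically.
    by_contra h
    have e : ((i : ℕ) : ℤ) = -1 + 1 := by omega
    have := c.transition (-1) (by rw [c.mate_eq_self (out _ (by omega))]) (by rw [← e]; omega)
      (c.red_left _ (out _ (by omega)) (by omega)) (by rw [← e]; simpa using h)
    omega
  | finish i hi =>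
    have hne := hf i (Finset.mem_singleton_self i)
    have hm := hc.mate_mem i
    simp only [colour_eq_blue, shape_eq_trivial, shape_eq_closing]
    refine ⟨?_, by omega⟩
    by_contra h
    have := c.transition (i : ℕ) (by omega) (by rw [c.mate_eq_self (out _ (by omega))])
      (by simpa using h) (c.red_right _ (out _ (by omega)) (by omega))
    omega
  | pointers i j =>
    simp only [hc.pointer_eq]
    intro h
    rw [← h, c.mate_mate]
  | selfPaired i =>
    simp only [Paired, hc.pointer_eq, shape_eq_trivial]
    exact And.left
  | paired i j hij =>
    simp only [Paired, hc.pointer_eq, shape_eq_opening, shape_eq_closing]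
    rintro ⟨h₁, h₂⟩
    have hlt : (i : ℕ) < (j : ℕ) := hij
    refine ⟨by omega, by omega, ?_⟩
    have := c.red_mate (i : ℕ)
    rw [h₁] at this
    simp [symbol, Symbol.colour, this]
  | nesting i i' j j' h₁ h₂ h₃ =>
    simp only [Paired, hc.pointer_eq]
    rintro ⟨⟨e₁, -⟩, e₂, -⟩
    have h₁' : (i : ℕ) < (i' : ℕ) := h₁
    have h₂' : (i' : ℕ) < (j : ℕ) := h₂
    have h₃' : (j : ℕ) < (j' : ℕ) := h₃
    exact c.nesting (i : ℕ) (i' : ℕ) (by omega) (by omega) (by omega)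
  | noTransition i j hij =>
    have hi := hf i (by simp)
    have hj := hf j (by simp)
    simp only [colour_eq_red, colour_eq_blue, shape_eq_trivial, shape_eq_closing,
      shape_eq_opening]
    rintro ⟨⟨h₁, h₂⟩, h₃, h₄⟩
    have e : ((j : ℕ) : ℤ) = (i : ℕ) + 1 := by omega
    have := c.transition (i : ℕ) (by omega) (by rw [← e]; omega) h₁ (by rw [← e]; exact h₃)
    omega

end Layout

/-! ### From refutations to the game -/

section

variable {n k : ℕ}

/-- The cells mentioned by a clause over the bits. -/
def cells (D : Clause (BitVar n)) : Finset ℤ := D.image fun l => ((l.1.1 : ℕ) : ℤ)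

theorem card_cells_le (D : Clause (BitVar n)) : (cells D).card ≤ indexWidth D := by
  have : cells D = (D.image fun l => l.1.1).image fun i : Fin n => ((i : ℕ) : ℤ) := by
    rw [Finset.image_image]
    rfl
  rw [this]
  exact Finset.card_image_le

theorem mem_cells {D : Clause (BitVar n)} {l : Literal (BitVar n)} (h : l ∈ D) :
    ((l.1.1 : ℕ) : ℤ) ∈ cells D := Finset.mem_image_of_mem _ h

/-- The cells mentioned by a clause over the extension variables. -/
def extCells (L : Clause (ExtVar n k)) : Finset ℤ := L.biUnion fun l => cells l.1.1

theorem cells_subset_extCells {L : Clause (ExtVar n k)} {l : Literal (ExtVar n k)} (h : l ∈ L) :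
    cells l.1.1 ⊆ extCells L := Finset.subset_biUnion_of_mem (fun l => cells l.1.1) h

theorem extCells_mono {L M : Clause (ExtVar n k)} (h : L ⊆ M) : extCells L ⊆ extCells M :=
  Finset.biUnion_subset_biUnion_of_subset_left _ h

theorem extCells_insert (l : Literal (ExtVar n k)) (L : Clause (ExtVar n k)) :
    extCells (insert l L) = cells l.1.1 ∪ extCells L := Finset.biUnion_insert

theorem card_extCells_le (L : Clause (ExtVar n k)) : (extCells L).card ≤ L.card * k :=
  Finset.card_biUnion_le_card_mul _ _ _ fun l _ => (card_cells_le l.1.1).trans l.1.2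

/-- The clause `D` is satisfied by the codes of the symbols of `s`. -/
def Satisfied (π : Encoding n) (s : Fin n → Symbol n) (D : Clause (BitVar n)) : Prop :=
  ∃ l ∈ D, π (s l.1.1) l.1.2 = l.2

/-- The clause `L` is falsified when each `y_D` is given the truth value of `D`. -/
def Falsified (π : Encoding n) (s : Fin n → Symbol n) (L : Clause (ExtVar n k)) : Prop :=
  ∀ l ∈ L, Satisfied π s l.1.1 ↔ l.2 = false

theorem Falsified.mono {π : Encoding n} {s : Fin n → Symbol n} {L M : Clause (ExtVar n k)}
    (h : Falsified π s M) (hLM : L ⊆ M) : Falsified π s L := fun l hl => h l (hLM hl)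

theorem satisfied_congr (π : Encoding n) {c d : Layout} {D : Clause (BitVar n)}
    (h : ∀ x ∈ cells D, c.SameAt d x) : Satisfied π d.symbol D ↔ Satisfied π c.symbol D := by
  refine exists_congr fun l => and_congr_right fun hl => ?_
  rw [(h _ (mem_cells hl)).symbol_eq]

theorem Falsified.congr {π : Encoding n} {c d : Layout} {L : Clause (ExtVar n k)}
    (hL : Falsified π c.symbol L) (h : ∀ x ∈ extCells L, c.SameAt d x) :
    Falsified π d.symbol L := fun l hl =>
  (satisfied_congr π fun x hx => h x (cells_subset_extCells hl hx)).trans (hL l hl)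

theorem satisfied_union (π : Encoding n) (s : Fin n → Symbol n) (A B : Clause (BitVar n)) :
    Satisfied π s (A ∪ B) ↔ Satisfied π s A ∨ Satisfied π s B := by
  simp only [Satisfied, Finset.mem_union, or_and_right, exists_or]

theorem image_excludingClause_subset (S : Finset (Fin n)) (β : Fin n → Fin (codeLength n) → Bool) :
    (excludingClause S β).image (fun l => l.1.1) ⊆ S := by
  intro i hi
  simp only [excludingClause, Finset.mem_image, Finset.mem_product] at hi
  obtain ⟨_, ⟨v, hv, rfl⟩, rfl⟩ := hi
  exact hv.1

theorem formulaIndexWidth_le (π : Encoding n) : formulaIndexWidth (bracket π) ≤ 4 := by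
  have hle : ∀ x ∈ indexWidth '' bracket π, x ≤ 4 := by
    rintro _ ⟨D, ⟨C, hC, β, -, rfl⟩, rfl⟩
    refine (Finset.card_le_card (image_excludingClause_subset C.indices β)).trans ?_
    cases hC with
    | start | finish | selfPaired => simp
    | pointers | paired | noTransition => exact Finset.card_le_two.trans (by omega)
    | nesting => exact Finset.card_le_four
  rcases (indexWidth '' bracket π).eq_empty_or_nonempty with h | h
  · simp [formulaIndexWidth, h]
  · exact csSup_le h hle

/-- The clauses of the narrow formula are not falsified by a layout whose anchor is not mentioned
by the clause. -/
theorem not_falsified (π : Encoding n) (hn : 1 < n) {c : Layout} (hc : c.Confined n)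
    {L : Clause (ExtVar n (formulaIndexWidth (bracket π)))} (hL : L ∈ exBracket π)
    (hf : c.anchor ∉ extCells L) : ¬ Falsified π c.symbol L := by
  intro h
  cases hL with
  | unit D hD =>
    have hunsat : ¬ Satisfied π c.symbol D.1 := by
      have := h (D, true) (Finset.mem_singleton_self _)
      simpa using this
    obtain ⟨C, hC, β, hβ, hDβ⟩ := hD
    -- With codes of length zero the clause would mention no cell, and the anchor could be an index
    -- of the axiom without lying in `extCells`.
    have hpos : 0 < codeLength n := by
      refine Nat.clog_pos one_lt_two ?_
      have : Nontrivial (Symbol n) :=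
        ⟨((.red, .trivial), ⟨0, by omega⟩), ((.blue, .trivial), ⟨0, by omega⟩), by simp⟩
      have : Finite (Symbol n) := Finite.of_injective π π.injective
      exact Finite.one_lt_card
    have hmem : ∀ i ∈ C.indices, ∀ b, ((i, b), !(β i b)) ∈ D.1 := by
      intro i hi b
      rw [hDβ, excludingClause]
      exact Finset.mem_image.2 ⟨(i, b), by simp [hi], rfl⟩
    refine hβ ⟨c.symbol, fun i hi => funext fun b => ?_, hc.holds hC fun i hi e => hf ?_⟩
    · by_contra hne
      exact hunsat ⟨_, hmem i hi b, Bool.eq_not.2 hne⟩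
    · rw [← e]
      exact cells_subset_extCells (Finset.mem_singleton_self _) (mem_cells (hmem i hi ⟨0, hpos⟩))
  | negation_pos x P N hP hN =>
    have h₁ := h (P, true) (by simp)
    have h₂ := h (N, true) (by simp)
    simp only [hP, hN, Satisfied, Finset.mem_singleton, exists_eq_left, Bool.true_eq_false,
      iff_false, Bool.not_eq_true, Bool.not_eq_false] at h₁ h₂
    simp_all
  | negation_neg x P N hP hN =>
    have h₁ := h (P, false) (by simp)
    have h₂ := h (N, false) (by simp)
    simp only [hP, hN, Satisfied, Finset.mem_singleton, exists_eq_left, iff_true] at h₁ h₂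
    simp_all
  | disjunction A B D hD =>
    have h₁ := h (D, false) (by simp)
    have h₂ := h (A, true) (by simp)
    have h₃ := h (B, true) (by simp)
    have := satisfied_union π c.symbol A.1 B.1
    rw [← hD] at this
    simp_all
  | disjunction_left A B D hD =>
    have h₁ := h (A, false) (by simp)
    have h₂ := h (D, true) (by simp)
    have := satisfied_union π c.symbol A.1 B.1
    rw [← hD] at this
    simp_all
  | disjunction_right A B D hD =>
    have h₁ := h (B, false) (by simp)
    have h₂ := h (D, true) (by simp)
    have := satisfied_union π c.symbol A.1 B.1
    rw [← hD] at this
    simp_all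

/-- If the adversary survives `t` rounds on a falsified line, then the line has depth at
least `t`. -/
theorem le_lineDepth (π : Encoding n) (hn : 1 < n) (R : Refutation (exBracket π)) {w : ℕ}
    {Q : Finset ℤ → Layout → Prop} (t : ℕ) : ∀ (i : Fin R.size) (c : Layout),
    ((∀ j, (extCells (R.line j)).card ≤ w) ∨
      (extCells (R.line i)).card + 4 * R.lineDepth i ≤ w) →
    Survives n w Q t (extCells (R.line i)) c → Falsified π c.symbol (R.line i) →
    t ≤ R.lineDepth i := by
  induction t with
  | zero => exact fun _ _ _ _ _ => Nat.zero_le _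
  | succ t ih =>
    intro i c hw hS hF
    have next : ∀ (j : Fin R.size) (Z : Finset ℤ) (d : Layout), Z.card ≤ 4 →
        R.lineDepth j + 1 ≤ R.lineDepth i →
        (∀ S' ⊆ extCells (R.line i) ∪ Z, S'.card ≤ w → Survives n w Q t S' d) →
        extCells (R.line j) ⊆ extCells (R.line i) ∪ Z → Falsified π d.symbol (R.line j) →
        t + 1 ≤ R.lineDepth i := by
      intro j Z d hZ hij hd hsub hFj
      have hcard := (Finset.card_le_card hsub).trans (Finset.card_union_le _ _)
      -- The second alternative needs no width bound: a step adds at most four cells and uses up one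
      -- unit of depth.
      have hw' : (∀ j, (extCells (R.line j)).card ≤ w) ∨
          (extCells (R.line j)).card + 4 * R.lineDepth j ≤ w := hw.imp_right fun h => by omega
      have hjw : (extCells (R.line j)).card ≤ w := by
        rcases hw' with h | h
        · exact h j
        · omega
      have := ih j d hw' (hd _ hsub hjw) hFj
      omega
    cases hstep : R.step i with
    | hypothesis h =>
      obtain ⟨d, hd₁, hd₂, hd₃, -⟩ := hS ∅ (by simp)
      rw [Finset.union_empty] at hd₃
      exact absurd (hF.congr hd₁) (not_falsified π hn hd₂ h hd₃)
    | weaken j hj h =>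
      have hdepth : R.lineDepth i = R.lineDepth j + 1 := by
        rw [Refutation.lineDepth, hstep]
      obtain ⟨d, hd₁, -, -, hd₄⟩ := hS ∅ (by simp)
      exact next j ∅ d (by simp) hdepth.ge hd₄
        ((extCells_mono h).trans Finset.subset_union_left) ((hF.congr hd₁).mono h)
    | resolve j k hj hk x A B hA hB h =>
      have hdepth : R.lineDepth i = max (R.lineDepth j) (R.lineDepth k) + 1 := by
        rw [Refutation.lineDepth, hstep]
      have hx : (cells x.1).card ≤ 4 :=
        (card_cells_le x.1).trans (x.2.trans (formulaIndexWidth_le π))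
      obtain ⟨d, hd₁, -, -, hd₄⟩ := hS (cells x.1) hx
      have hFd := hF.congr hd₁
      -- The truth value of the resolved variable in the answering layout selects the falsified
      -- premise.
      by_cases hsat : Satisfied π d.symbol x.1
      · refine next k (cells x.1) d hx (by omega) hd₄ ?_ ?_
        · rw [hB, extCells_insert, Finset.union_comm]
          exact Finset.union_subset_union_left
            (extCells_mono (h ▸ Finset.subset_union_right))
        · rw [hB]
          intro l hl
          rcases Finset.mem_insert.1 hl with rfl | hl
          · simpa using hsat
          · exact hFd l (h ▸ Finset.mem_union_right A hl)
      · refine next j (cells x.1) d hx (by omega) hd₄ ?_ ?_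
        · rw [hA, extCells_insert, Finset.union_comm]
          exact Finset.union_subset_union_left
            (extCells_mono (h ▸ Finset.subset_union_left))
        · rw [hA]
          intro l hl
          rcases Finset.mem_insert.1 hl with rfl | hl
          · simpa using hsat
          · exact hFd l (h ▸ Finset.mem_union_left B hl)

theorem rounds_le_depth (π : Encoding n) (hn : 1 < n) (R : Refutation (exBracket π)) {w k : ℕ}
    (hw : 1 ≤ w) (hk : windowLength w k ≤ n) (h : R.width * 4 ≤ w ∨ 4 * R.depth ≤ w) :
    rounds w k ≤ R.depth := by
  have e : extCells (R.line R.final) = ∅ := by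
    rw [R.line_final]
    rfl
  refine le_lineDepth π hn R _ R.final (Layout.blank 0) (h.imp (fun h j => ?_) fun h => ?_) ?_ ?_
    (w := w) (Q := fun _ _ => True)
  · refine (card_extCells_le _).trans (le_trans ?_ h)
    exact Nat.mul_le_mul (Finset.le_sup (f := fun i => (R.line i).card) (Finset.mem_univ j))
      (formulaIndexWidth_le π)
  · rw [e, Finset.card_empty, zero_add]
    exact h
  · rw [e]
    exact survives_blank hw hk
  · rw [R.line_final]
    exact fun l hl => absurd hl (Finset.notMem_empty l)

end

end BracketFormula

namespace BracketFormula

/-! ### Asymptotics -/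

/-- The number of rounds is the product of the window lengths of the lower levels, so the exponents
`0, …, k - 1` add up. The factors `7` are dropped. -/
theorem log_rounds_ge {w : ℕ} (hw : 1 ≤ w) (k : ℕ) :
    (k * (k - 1) / 2 : ℝ) * Real.log (10 * w ^ 2) ≤ Real.log (rounds w k) := by
  have hw' : (0 : ℝ) < w := by exact_mod_cast hw
  induction k with
  | zero => simp [rounds]
  | succ k ih =>
    have hr : (0 : ℝ) < rounds w k := by exact_mod_cast rounds_pos hw k
    have e : ((rounds w (k + 1) : ℕ) : ℝ) = 7 * (10 * (w : ℝ) ^ 2) ^ k * rounds w k := by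
      simp only [rounds, windowLength]
      push_cast
      ring
    have hq : (0 : ℝ) < 10 * (w : ℝ) ^ 2 := by positivity
    rw [e]
    generalize 10 * (w : ℝ) ^ 2 = q at *
    rw [Real.log_mul (by positivity) hr.ne', Real.log_mul (by norm_num) (by positivity),
      Real.log_pow]
    have h7 : (0 : ℝ) ≤ Real.log 7 := Real.log_nonneg (by norm_num)
    rw [Nat.cast_succ]
    linarith

section

variable {n : ℕ} {π : Encoding n} (R : Refutation (exBracket π))

theorem depth_pos (hn : 7 ≤ n) : 0 < R.depth := by
  by_contra h
  have := rounds_le_depth π (by omega) R (w := 1) (k := 0) le_rfl (by simpa [windowLength] using hn)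
    (by omega)
  simp only [rounds] at this
  omega

/-- With memory `4 * R.depth` nothing need be forgotten. Two levels take `179200 * R.depth ^ 4`
cells and already allow more than `R.depth` rounds; one level would give only seven. -/
theorem le_depth_pow_four (hn : 7 ≤ n) : n ≤ 179200 * R.depth ^ 4 := by
  by_contra! h
  have hd := depth_pos R hn
  have := rounds_le_depth π (by omega) R (w := 4 * R.depth) (k := 2) (by omega)
    (by simp only [windowLength]; ring_nf; ring_nf at h; exact h.le) (Or.inr le_rfl)
  simp only [rounds, windowLength] at this
  nlinarith

theorem log_sq_le_of_width {w : ℕ} (hw : 2 ≤ w) (hR : R.width ≤ w) (hn : 7 ≤ n)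
    (h : 200 * Real.log w ≤ Real.log n) :
    Real.log n ^ 2 ≤ 400 * Real.log w * Real.log R.depth := by
  -- A clause with `w` literals mentions up to `4 * w` cells, since each variable has index-width at
  -- most four.
  set q : ℕ := 10 * (4 * w) ^ 2 with hq
  have hq1 : 1 < q := by
    rw [hq]
    nlinarith
  set k : ℕ := Nat.log q (n / 7) with hk
  have hk₁ : q ^ k ≤ n / 7 := Nat.pow_log_le_self q (by omega)
  have hk₂ : n / 7 < q ^ (k + 1) := Nat.lt_pow_succ_log_self hq1 _
  have hrounds : rounds (4 * w) k ≤ R.depth :=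
    rounds_le_depth π (by omega) R (by omega) (by rw [windowLength, ← hq]; omega) (by omega)
  have hw0 : (2 : ℝ) ≤ w := by exact_mod_cast hw
  have hl2 : Real.log 2 ≤ Real.log w := Real.log_le_log (by norm_num) hw0
  have hl2' : 0 < Real.log 2 := Real.log_pos (by norm_num)
  have h160 : Real.log 160 ≤ 8 * Real.log 2 := by
    rw [← Real.log_rpow (by norm_num)]
    exact Real.log_le_log (by norm_num) (by norm_num)
  have h160' : 0 ≤ Real.log 160 := Real.log_nonneg (by norm_num)
  have h7 : Real.log 7 ≤ 3 * Real.log 2 := by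
    rw [← Real.log_rpow (by norm_num)]
    exact Real.log_le_log (by norm_num) (by norm_num)
  have hlq : Real.log q = Real.log 160 + 2 * Real.log w := by
    have : (q : ℝ) = 160 * (w : ℝ) ^ 2 := by
      rw [hq]
      push_cast
      ring
    rw [this, Real.log_mul (by norm_num) (by positivity), Real.log_pow]
    norm_num
  have hn' : (n : ℝ) ≤ 7 * (q : ℝ) ^ (k + 1) := by
    have : n ≤ 7 * q ^ (k + 1) := by omega
    exact_mod_cast this
  have hL : Real.log n ≤ Real.log 7 + (k + 1) * Real.log q := by
    have hq0 : (0 : ℝ) < q := by exact_mod_cast (by omega : 0 < q)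
    have hn0 : (0 : ℝ) < n := by exact_mod_cast (by omega : 0 < n)
    refine (Real.log_le_log hn0 hn').trans_eq ?_
    rw [Real.log_mul (by norm_num) (by positivity), Real.log_pow]
    push_cast
    ring
  have hlog : (k * (k - 1) / 2 : ℝ) * Real.log q ≤ Real.log R.depth := by
    have h₁ := log_rounds_ge (w := 4 * w) (by omega) k
    have h₂ : Real.log (rounds (4 * w) k) ≤ Real.log R.depth :=
      Real.log_le_log (by exact_mod_cast rounds_pos (by omega) k) (by exact_mod_cast hrounds)
    refine le_trans (le_of_eq ?_) (h₁.trans h₂)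
    rw [hq]
    push_cast
    rfl
  set l := Real.log w
  set L := Real.log n
  have hl : 0 < l := hl2'.trans_le hl2
  have hkL : L ≤ (10 * k + 13) * l := by
    have : ((k : ℝ) + 1) * Real.log q ≤ (k + 1) * (10 * l) :=
      mul_le_mul_of_nonneg_left (by linarith) (by positivity)
    linarith
  -- The assumption `200 * l ≤ L` absorbs the rounding of `k` and the constants into a factor of
  -- two.
  have hk1 : L / 20 ≤ (k - 1) * l := by linarith
  have hk0 : 0 ≤ (k - 1 : ℝ) * l := by linarith
  have hsq : (L / 20) * (L / 20) ≤ (k * l) * ((k - 1) * l) :=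
    mul_le_mul (by linarith) hk1 (by linarith) (by positivity)
  have hk0' : 0 ≤ (k - 1 : ℝ) := nonneg_of_mul_nonneg_left hk0 hl
  have hfin : (k * (k - 1) / 2 : ℝ) * (2 * l) ≤ Real.log R.depth :=
    (mul_le_mul_of_nonneg_left (by linarith) (by positivity)).trans hlog
  nlinarith [mul_le_mul_of_nonneg_left hfin hl.le]

end

end BracketFormula

theorem theorem4 :
    ∃ c : ℝ, 0 < c ∧ ∃ N : ℕ, ∀ n : ℕ, N ≤ n →
      ∀ (π : BracketFormula.Encoding n) (w : ℕ), 2 ≤ w →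
        ∀ R : BracketFormula.Refutation (BracketFormula.exBracket π), R.width ≤ w →
          (n : ℝ) ^ (c * (Real.log n / Real.log w)) ≤ (R.depth : ℝ) := by
  -- If `log n ≤ 200 * log w`, the constant `1 / 1600` makes the exponent at most `1 / 8`. The
  -- fourth-root bound supplies this once `n ≥ 179200 ^ 2` makes its constant cost at most half of
  -- `log n`.
  refine ⟨1 / 1600, by norm_num, 179200 ^ 2, fun n hn π w hw R hR => ?_⟩
  have hn7 : 7 ≤ n := le_trans (by norm_num) hn
  have hd : (0 : ℝ) < R.depth := by exact_mod_cast BracketFormula.depth_pos R hn7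
  have hn0 : (0 : ℝ) < n := by exact_mod_cast (by omega : 0 < n)
  have hl : 0 < Real.log w := Real.log_pos (by exact_mod_cast hw)
  have hL : 0 ≤ Real.log n := Real.log_nonneg (by exact_mod_cast (by omega : 1 ≤ n))
  rw [Real.rpow_def_of_pos hn0, ← Real.le_log_iff_exp_le hd]
  rcases le_total (200 * Real.log w) (Real.log n) with h | h
  · have := BracketFormula.log_sq_le_of_width R hw hR hn7 h
    have e : Real.log n * (1 / 1600 * (Real.log n / Real.log w)) =
        Real.log n ^ 2 / (1600 * Real.log w) := by
      field_simp
    rw [e, div_le_iff₀ (by positivity)]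
    nlinarith [sq_nonneg (Real.log n)]
  · have h₁ : Real.log n / Real.log w ≤ 200 := (div_le_iff₀ hl).2 h
    have h₂ : Real.log n ≤ Real.log 179200 + 4 * Real.log R.depth := by
      have : (n : ℝ) ≤ 179200 * (R.depth : ℝ) ^ 4 := by
        exact_mod_cast BracketFormula.le_depth_pow_four R hn7
      refine (Real.log_le_log hn0 this).trans_eq ?_
      rw [Real.log_mul (by norm_num) (by positivity), Real.log_pow]
      norm_num
    have h₃ : 2 * Real.log 179200 ≤ Real.log n := by
      have : ((179200 : ℝ)) ^ 2 ≤ n := by exact_mod_cast hn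
      have := Real.log_le_log (by norm_num) this
      rw [Real.log_pow] at this
      exact_mod_cast this
    have := mul_le_mul_of_nonneg_left h₁ hL
    linarith
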